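/- Let $n\ge 1$, $m\ge 1$, $d\ge 0$ and $\lambda=(\lambda_1,\dots,\lambda_n)\in\mathbb C^n$. For multi-indices $i\in\mathbb N^m$ with $|i|\le d$ and $1\le j\le n$, let $f_{j,i}$ be a germ at $0\in\mathbb C^n$ of a holomorphic function with $f_{j,i}(z)=O(\|z\|^2)$, and consider for $t\in\mathbb C^m$ the germ of holomorphic vector field $X_t$ given by $$\dot z_j=\lambda_j z_j+\sum_{|i|\le d}t^i f_{j,i}(z),\qquad 1\le j\le n .$$ Write $(Q,\lambda)=\sum_k Q_k\lambda_k$ for $Q\in\mathbb N^n$. Assume that $0$ lies in the convex hull of $\{\lambda_1,\dots,\lambda_n\}$ (Siegel domain), and that the linear part is resonant: there are $Q\in\mathbb N^n$ with $|Q|\ge 2$ and an index $i$ such that $(Q,\lambda)=\lambda_i$. Assume that the resonances are generated by finitely many nonzero $r_1,\dots,r_l\in\mathbb N^n$ with $(r_j,\lambda)=0$, i.e. whenever $|Q|\ge2$ and $(Q,\lambda)=\lambda_i$, one has $Q=P+\sum_j c_jr_j$ with $c_j\in\mathbb N$ and $P\in\mathbb N^n$, $|P|\le 1$ (for instance $P=e_i$,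 the $i$-th unit vector). A formal normalization of $X_t$ is a formal change of variables $w=h_t(z)$ with $h_t(0)=0$, $D_0h_t=I$, which transforms $X_t$ into $$\dot w_i=\lambda_iw_i+\sum_{j=1}^l g_{i,j,t}(w)\,w^{r_j},\qquad 1\le i\le n,$$ with formal power series $g_{i,j,t}$ such that $g_{i,j,t}(0)=0$ if $|r_j|=1$. A polynomial family of formal normalizations is a family $(h_t)_{t\in\mathbb C^m}$ of formal normalizations of the $X_t$ whose coefficients are polynomials in $t$, the coefficients of the monomials of degree $N$ being of degree at most $C_0+C_1N$, with constants $C_0,C_1$ independent of $N$. Then polynomial families of formal normalizations exist, and for every such family $(h_t)$ the following dichotomy holds. Either 1) for all $t\in\mathbb C^m$ the formal normalization $h_t$ converges, and the germ at $0$ of the analytic set $\{w^{r_1}=0,\dots,w^{r_l}=0\}$, $w=h_t(z)$, is invariant under $X_t$; or 2) there is a set $E\subset\mathbb C^m$ of $\Gamma$-capacity $0$ such that $h_t$ diverges for all $t\in\mathbb C^m\setminus E$. Here the $\Gamma$-capacity (Ronkin) of $E\subset\mathbb C^m$ is the supremum over all unitary maps $U$ of $\mathbb C^m$ of the logarithmic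 capacity of the set obtained from $U(E)$ by applying $m-1$ times the operation which sends $F\subset\mathbb C^{k+1}$ to the set of $z'\in\mathbb C^k$ such that $\{w\in\mathbb C:(z',w)\in F\}$ has positive logarithmic capacity; the logarithmic capacity of $S\subset\mathbb C$ is $\sup_\mu\exp\iint\log|z-w|\,d\mu(z)\,d\mu(w)$, over Borel probability measures $\mu$ carried by compact subsets of $S$. -/

import Mathlib

open scoped ENNReal Matrix

noncomputable section

/-! Capacities -/

/-- Logarithmic capacity of `S ⊆ ℂ`: the supremum of `exp (∫∫ log |z - w| dμ dμ)` over all Borel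
probability measures `μ` carried by a compact subset of `S` and of finite logarithmic energy
(it is `0` if there is no such measure). A measure with an atom has infinite energy; since
`Real.log 0 = 0` in Mathlib, such measures have to be excluded explicitly. -/
def logCapacity (S : Set ℂ) : ℝ≥0∞ :=
  sSup {c : ℝ≥0∞ | ∃ (μ : MeasureTheory.Measure ℂ) (K : Set ℂ),
    MeasureTheory.IsProbabilityMeasure μ ∧ (∀ z, μ {z} = 0) ∧
    IsCompact K ∧ K ⊆ S ∧ μ Kᶜ = 0 ∧
    MeasureTheory.Integrable (fun p : ℂ × ℂ => Real.log ‖p.1 - p.2‖) (μ.prod μ) ∧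
    c = ENNReal.ofReal (Real.exp (∫ p : ℂ × ℂ, Real.log ‖p.1 - p.2‖ ∂(μ.prod μ)))}

/-- The `Γ`-projection of `E ⊆ ℂ^(k+1)` to `ℂ^k`: the points over which the fibre of `E` in the
direction of the last coordinate has positive logarithmic capacity. -/
def gammaProjection {k : ℕ} (E : Set (Fin (k + 1) → ℂ)) : Set (Fin k → ℂ) :=
  {z | 0 < logCapacity {w : ℂ | (Fin.snoc z w : Fin (k + 1) → ℂ) ∈ E}}

/-- The iterated `Γ`-projection of `E ⊆ ℂ^(k+1)` to the first coordinate line. -/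
def gammaProjectionLine : (k : ℕ) → Set (Fin (k + 1) → ℂ) → Set ℂ
  | 0, E => {w : ℂ | (fun _ => w) ∈ E}
  | k + 1, E => gammaProjectionLine k (gammaProjection E)

/-- Ronkin's `Γ`-capacity of `E ⊆ ℂ^m` (`m ≥ 1`): the supremum, over all unitary changes of
coordinates, of the logarithmic capacity of the iterated `Γ`-projection to a line.
The value for `m = 0` is a convention. -/
def gammaCapacity : (m : ℕ) → Set (Fin m → ℂ) → ℝ≥0∞
  | 0, _ => 0
  | k + 1, E => ⨆ U : Matrix.unitaryGroup (Fin (k + 1)) ℂ,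
      logCapacity (gammaProjectionLine k
        ((fun z : Fin (k + 1) → ℂ => (U : Matrix (Fin (k + 1)) (Fin (k + 1)) ℂ) *ᵥ z) '' E))

/-! Convergent power series -/

/-- The term of multi-index `Q` of the series `F` at the point `z`. -/
def seriesTerm {n : ℕ} (F : MvPowerSeries (Fin n) ℂ) (z : Fin n → ℂ) (Q : Fin n →₀ ℕ) : ℂ :=
  MvPowerSeries.coeff Q F * ∏ k, z k ^ Q k

/-- `F` converges (absolutely) on the open polydisc of radius `ρ` about `0`. -/
def ConvergesOnPolydisc {n : ℕ} (F : MvPowerSeries (Fin n) ℂ) (ρ : ℝ) : Prop :=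
  ∀ z ∈ Metric.ball (0 : Fin n → ℂ) ρ, Summable (seriesTerm F z)

/-- `F` is a convergent power series, i.e. the germ at `0` of a holomorphic function. -/
def IsConvergentSeries {n : ℕ} (F : MvPowerSeries (Fin n) ℂ) : Prop :=
  ∃ ρ : ℝ, 0 < ρ ∧ ConvergesOnPolydisc F ρ

/-- The sum of `F` at `z` (meaningful where `F` converges). -/
def seriesSum {n : ℕ} (F : MvPowerSeries (Fin n) ℂ) (z : Fin n → ℂ) : ℂ :=
  ∑' Q, seriesTerm F z Q

/-! Resonances -/

/-- The pairing `(Q, lam) = ∑ Q_k lam_k`. -/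
def pairing {n : ℕ} (Q : Fin n →₀ ℕ) (lam : Fin n → ℂ) : ℂ := ∑ k, (Q k : ℂ) * lam k

/-- `Q` is a resonance for the `i`-th eigenvalue. -/
def IsResonance {n : ℕ} (lam : Fin n → ℂ) (i : Fin n) (Q : Fin n →₀ ℕ) : Prop :=
  2 ≤ Q.degree ∧ pairing Q lam = lam i

/-- The resonances are generated by `r_1, …, r_l`: each `r_j` is nonzero with `(r_j, lam) = 0`, and
every resonance is obtained from a multi-index of degree at most one (such as the trivial relation
`e_i`) by adding a combination of the `r_j` with coefficients in `ℕ`. -/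
def ResonancesGeneratedBy {n l : ℕ} (lam : Fin n → ℂ) (r : Fin l → (Fin n →₀ ℕ)) : Prop :=
  (∀ j, r j ≠ 0 ∧ pairing (r j) lam = 0) ∧
  ∀ i Q, IsResonance lam i Q →
    ∃ (P : Fin n →₀ ℕ) (c : Fin l → ℕ), P.degree ≤ 1 ∧ Q = P + ∑ j, c j • r j

/-! Polynomial families of vector fields and their formal normalizations -/

/-- The components `lam_j z_j + ∑_{|i| ≤ d} t^i f_{i,j}(z)` of the vector field of parameter `t`. -/
def vectorFieldFamily {n m : ℕ} (lam : Fin n → ℂ) (d : ℕ)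
    (f : (Fin m →₀ ℕ) → Fin n → MvPowerSeries (Fin n) ℂ) (t : Fin m → ℂ) :
    Fin n → MvPowerSeries (Fin n) ℂ := fun j =>
  lam j • MvPowerSeries.X j +
    ∑ e ∈ Finset.range (d + 1), ∑ i ∈ Finset.finsuppAntidiag Finset.univ e,
      (∏ s, t s ^ i s) • f i j

/-- `w = h(z)`, with `h(0) = 0` and `D₀h = I`, is a formal change of variables transforming the
formal vector field `X` into `w_i' = lam_i w_i + g_i(w)`, where `g_i = ∑_j G_{i,j} w^{r_j}` and
`G_{i,j}(0) = 0` whenever `|r_j| = 1`. The last identity is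
`∑_k (∂h_i/∂z_k) X_k = lam_i h_i + g_i ∘ h`. -/
def IsFormalNormalization {n l : ℕ} (lam : Fin n → ℂ) (r : Fin l → (Fin n →₀ ℕ))
    (X h : Fin n → MvPowerSeries (Fin n) ℂ) : Prop :=
  (∀ i, MvPowerSeries.constantCoeff (h i) = 0) ∧
  (∀ i k, MvPowerSeries.coeff (Finsupp.single k 1) (h i) = if i = k then 1 else 0) ∧
  ∃ G : Fin n → Fin l → MvPowerSeries (Fin n) ℂ,
    (∀ i j, (r j).degree = 1 → MvPowerSeries.constantCoeff (G i j) = 0) ∧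
    ∀ i, ∑ k, MvPowerSeries.pderiv ℂ k (h i) * X k =
      lam i • h i +
        MvPowerSeries.subst h (∑ j, G i j * MvPowerSeries.monomial (r j) (1 : ℂ))

/-- The value at `t` of a formal map whose coefficients are polynomials in the parameters. -/
def specialize {n m : ℕ} (h : Fin n → MvPowerSeries (Fin n) (MvPolynomial (Fin m) ℂ))
    (t : Fin m → ℂ) : Fin n → MvPowerSeries (Fin n) ℂ := fun i =>
  MvPowerSeries.map (MvPolynomial.eval t) (h i)

/-- `h` is a family of formal normalizations `h_t` of the family `X_t`, whose coefficients are
polynomials in `t`, the degree of the coefficients of the monomials of degree `N` being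
at most `C₀ + C₁ N`. -/
def IsPolynomialNormalization {n m l : ℕ} (lam : Fin n → ℂ) (r : Fin l → (Fin n →₀ ℕ))
    (X : (Fin m → ℂ) → Fin n → MvPowerSeries (Fin n) ℂ)
    (h : Fin n → MvPowerSeries (Fin n) (MvPolynomial (Fin m) ℂ)) : Prop :=
  (∀ t, IsFormalNormalization lam r (X t) (specialize h t)) ∧
  ∃ C₀ C₁ : ℕ, ∀ i Q, (MvPowerSeries.coeff Q (h i)).totalDegree ≤ C₀ + C₁ * Q.degree

/-- The set `{w^{r_1} = … = w^{r_l} = 0}`, where `w = h(z)`. -/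
def resonantSet {n l : ℕ} (r : Fin l → (Fin n →₀ ℕ)) (h : Fin n → MvPowerSeries (Fin n) ℂ) :
    Set (Fin n → ℂ) :=
  {z | ∀ j, ∏ k, seriesSum (h k) z ^ (r j) k = 0}

/-- The germ at `0` of the resonant set is invariant under the holomorphic vector field `X`: in
some polydisc about `0` on which `X` and `h` converge, every trajectory (with complex
time in a connected open set) that meets the resonant set is contained in it. -/
def ResonantSetInvariant {n l : ℕ} (r : Fin l → (Fin n →₀ ℕ))
    (X h : Fin n → MvPowerSeries (Fin n) ℂ) : Prop :=
  ∃ ρ : ℝ, 0 < ρ ∧ (∀ i, ConvergesOnPolydisc (X i) ρ) ∧ (∀ i, ConvergesOnPolydisc (h i) ρ) ∧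
    ∀ (D : Set ℂ) (γ : ℂ → Fin n → ℂ), IsOpen D → IsPreconnected D →
      (∀ s ∈ D, γ s ∈ Metric.ball (0 : Fin n → ℂ) ρ ∧
        HasDerivAt γ (fun i => seriesSum (X i) (γ s)) s) →
      (∃ s ∈ D, γ s ∈ resonantSet r h) → ∀ s ∈ D, γ s ∈ resonantSet r h

end

/-!
The family `h_t` converges exactly when its coefficients grow at most geometrically
(`forall_isConvergentSeries_iff_geometric_bound`), so the set of the parameters of convergence is a
*growth set* of a sequence of polynomials in `t` whose degrees grow linearly. The dichotomy rests on
the fact that a growth set of nonzero `Γ`-capacity is the whole space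
(`mem_growthSet_of_gammaCapacity_ne_zero`). In one variable this is a Bernstein–Walsh inequality,
obtained without equilibrium measures: a measure of finite energy has a potential which is bounded on
a compact set `F` of positive measure; the restriction of the measure to `F` then has a potential
bounded everywhere, and averaging over `F` the comparison of `|p(z)|` with `|p(x)|` through the roots
of `p` gives `|p(z)| ≤ C ^ deg p * sup_F |p|` (`bernstein_walsh`). Several variables are treated one
at a time, along the very definition of the iterated `Γ`-projection.

When `h_t` converges, let `ψ` be its inverse and `u_i = X(h_i) - lam_i h_i`. The formal identity
`u = g ∘ h` shows that `u ∘ ψ` is flat at `0` on each line in the set where all `w ^ r_j` vanish,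
because every monomial of `g` is divisible by some `w ^ r_j`; hence `u ∘ ψ` vanishes on this set
(`normalFormDefect_comp_inverse_eq_zero`). The convergence of the series `g`, or of the cofactors of
the `w ^ r_j`, is not needed. Invariance follows by Grönwall's inequality
(`resonantSetInvariant_of_isConvergentSeries`).

Polynomial families exist by the Poincaré–Dulac construction over the ring of polynomials in `t`
(`exists_formal_normal_form`): the coefficients of degree `N` have degree at most `d (N - 1)` in `t`,
a bound which is stable under products and substitutions.
-/

noncomputable section

/-! ### Capacity and polynomial inequalities -/

section

open MeasureTheory in
/-- If `S` has positive capacity and is covered by countably many closed sets, one of them carries a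
probability measure on a compact set, with the positive part `log⁺ ‖z - ζ‖⁻¹` of the logarithmic
kernel having integrals bounded uniformly in `ζ`. -/
theorem exists_measure_bounded_potential {S : Set ℂ} (hS : 0 < logCapacity S) {A : ℕ → Set ℂ}
    (hA : ∀ k, IsClosed (A k)) (hSA : S ⊆ ⋃ k, A k) :
    ∃ (k : ℕ) (F : Set ℂ) (ν : Measure ℂ) (M : ℝ≥0∞), F ⊆ A k ∧ IsCompact F ∧
      IsProbabilityMeasure ν ∧ ν Fᶜ = 0 ∧ (∀ z, ν {z} = 0) ∧ M ≠ ⊤ ∧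
      ∀ ζ, ∫⁻ z, ENNReal.ofReal (Real.posLog ‖z - ζ‖⁻¹) ∂ν ≤ M := by
  obtain ⟨c, ⟨μ, K, hμ, hatom, hK, hKS, hKc, hint, -⟩, -⟩ := lt_sSup_iff.1 hS
  set κ : ℂ → ℂ → ℝ≥0∞ := fun ζ z => ENNReal.ofReal (Real.posLog ‖z - ζ‖⁻¹) with hκ
  have hκm : Measurable (Function.uncurry κ) := by
    refine ENNReal.measurable_ofReal.comp (Real.continuous_posLog.measurable.comp ?_)
    exact ((measurable_snd.sub measurable_fst).norm).inv
  set V : ℂ → ℝ≥0∞ := fun ζ => ∫⁻ z, κ ζ z ∂μ with hV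
  have hVm : Measurable V := hκm.lintegral_prod_right'
  have hVfin : ∀ᵐ ζ ∂μ, V ζ < ⊤ := by
    refine ae_lt_top hVm ?_
    have h1 : ∫⁻ ζ, V ζ ∂μ = ∫⁻ p, Function.uncurry κ p ∂(μ.prod μ) :=
      (lintegral_prod _ hκm.aemeasurable).symm
    rw [h1]
    refine ((lintegral_mono fun p => ?_).trans_lt hint.2).ne
    rw [← ofReal_norm]
    refine ENNReal.ofReal_le_ofReal ?_
    rw [Real.posLog_apply, Real.log_inv, norm_sub_rev]
    exact max_le (norm_nonneg _) (neg_le_abs _)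
  have hKm := hK.measurableSet
  -- Finite energy makes the potential `V` finite almost everywhere, so it is bounded by some `j` on
  -- a part of positive measure of some `A k`; the measure will be restricted to a compact part `F`.
  obtain ⟨⟨k, j⟩, hkj⟩ : ∃ q : ℕ × ℕ, μ (K ∩ A q.1 ∩ {ζ | V ζ ≤ q.2}) ≠ 0 := by
    by_contra! hcon
    have h0 : μ (⋃ q : ℕ × ℕ, (K ∩ A q.1 ∩ {ζ | V ζ ≤ q.2})) = 0 := measure_iUnion_null hcon
    have hall : ∀ᵐ z ∂μ, False := by
      have hzK : ∀ᵐ z ∂μ, z ∈ K := hKc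
      have hzU : ∀ᵐ z ∂μ, z ∉ ⋃ q : ℕ × ℕ, (K ∩ A q.1 ∩ {ζ | V ζ ≤ q.2}) :=
        measure_eq_zero_iff_ae_notMem.1 h0
      filter_upwards [hzK, hzU, hVfin] with z hz1 hz2 hz3
      obtain ⟨k, hk⟩ := Set.mem_iUnion.1 (hSA (hKS hz1))
      obtain ⟨j, hj⟩ := ENNReal.exists_nat_gt hz3.ne
      exact hz2 (Set.mem_iUnion.2 ⟨(k, j), ⟨⟨hz1, hk⟩, hj.le⟩⟩)
    exact IsProbabilityMeasure.ne_zero μ (by simpa using hall)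
  have hmeas : MeasurableSet (K ∩ A k ∩ {ζ | V ζ ≤ j}) :=
    (hKm.inter (hA k).measurableSet).inter (hVm measurableSet_Iic)
  obtain ⟨F, hFs, hF, hμF⟩ := hmeas.exists_lt_isCompact_of_ne_top (measure_ne_top μ _)
    (pos_iff_ne_zero.2 hkj)
  have hμF' : μ F ≠ ⊤ := measure_ne_top μ _
  refine ⟨k, F, (μ F)⁻¹ • μ.restrict F, (μ F)⁻¹ * (ENNReal.ofReal (Real.log 2) + j),
    fun z hz => (hFs hz).1.2, hF, ⟨?_⟩, ?_, ?_, ?_, fun ζ => ?_⟩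
  · simp [ENNReal.inv_mul_cancel hμF.ne' hμF']
  · simp [Measure.restrict_apply hF.measurableSet.compl]
  · intro z
    have : μ.restrict F {z} = 0 := le_antisymm ((Measure.restrict_le_self _).trans (hatom z).le)
      zero_le
    simp [this]
  · exact ENNReal.mul_ne_top (ENNReal.inv_ne_top.2 hμF.ne') (by finiteness)
  · rw [lintegral_smul_measure, smul_eq_mul]
    gcongr
    -- The bound on `F` extends to any `ζ` by comparison with the point `ζ'` of `F` nearest to `ζ`:
    -- `‖z - ζ'‖ ≤ 2 ‖z - ζ‖` for `z ∈ F`. The point `z = ζ'`, at which the inverse of the norm has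
    -- the value `0`, is negligible since `μ` has no atoms.
    have hne : F.Nonempty := nonempty_of_measure_ne_zero hμF.ne'
    obtain ⟨ζ', hζ', hdist⟩ := hF.exists_infDist_eq_dist hne ζ
    have hVζ' : V ζ' ≤ j := (hFs hζ').2
    calc ∫⁻ z in F, κ ζ z ∂μ ≤ ∫⁻ z in F, (ENNReal.ofReal (Real.log 2) + κ ζ' z) ∂μ := by
          refine lintegral_mono_ae ?_
          have h2 : ∀ᵐ z ∂(μ.restrict F), z ≠ ζ' :=
            ae_restrict_of_ae (measure_eq_zero_iff_ae_notMem.1 (hatom ζ'))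
          filter_upwards [ae_restrict_mem hF.measurableSet, h2] with z hzF hz
          have hzpos : 0 < ‖z - ζ'‖ := norm_pos_iff.2 (sub_ne_zero.2 hz)
          have h3 : ‖z - ζ'‖ ≤ 2 * ‖z - ζ‖ := by
            have h4 : dist ζ ζ' ≤ dist ζ z := by
              rw [← hdist]; exact Metric.infDist_le_dist_of_mem hzF
            have h5 := dist_triangle z ζ ζ'
            rw [dist_comm ζ z] at h4
            rw [← dist_eq_norm, ← dist_eq_norm]
            linarith
          have h6 : ‖z - ζ‖⁻¹ ≤ 2 * ‖z - ζ'‖⁻¹ := by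
            have : 0 < ‖z - ζ‖ := by linarith
            rw [inv_le_iff_one_le_mul₀ this, mul_right_comm, ← div_eq_mul_inv, le_div_iff₀ hzpos]
            linarith
          have h7 : Real.posLog ‖z - ζ‖⁻¹ ≤ Real.log 2 + Real.posLog ‖z - ζ'‖⁻¹ := by
            refine (Real.posLog_le_posLog (by positivity) h6).trans ?_
            exact_mod_cast Real.posLog_nat_mul (n := 2) (x := ‖z - ζ'‖⁻¹)
          rw [hκ, ← ENNReal.ofReal_add (Real.log_nonneg (by norm_num)) Real.posLog_nonneg]
          exact ENNReal.ofReal_le_ofReal h7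
      _ ≤ ENNReal.ofReal (Real.log 2) + V ζ' := by
          rw [lintegral_add_left measurable_const]
          gcongr
          · simp only [lintegral_const, Measure.restrict_apply MeasurableSet.univ, Set.univ_inter]
            exact mul_le_of_le_one_right' prob_le_one
          · exact setLIntegral_le_lintegral _ _
      _ ≤ _ := by gcongr

/-- Each factor satisfies `‖z - ζ‖ ≤ R + ‖x - ζ‖ ≤ ‖x - ζ‖ (1 + R) max(1, ‖x - ζ‖⁻¹)`. -/
theorem prod_norm_sub_le (s : Multiset ℂ) {x z : ℂ} {R : ℝ} (hx : x ∉ s) (hR : ‖z - x‖ ≤ R) :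
    (s.map fun ζ => ‖z - ζ‖).prod ≤ (s.map fun ζ => ‖x - ζ‖).prod *
      Real.exp (s.card * Real.log (1 + R) + (s.map fun ζ => Real.posLog ‖x - ζ‖⁻¹).sum) := by
  have hR0 : 0 ≤ R := (norm_nonneg _).trans hR
  induction s using Multiset.induction with
  | empty => simp
  | cons ζ s ih =>
    rw [Multiset.mem_cons, not_or] at hx
    have hpos : 0 < ‖x - ζ‖ := norm_pos_iff.2 (sub_ne_zero.2 hx.1)
    have h1 : ‖z - ζ‖ ≤ ‖x - ζ‖ * Real.exp (Real.log (1 + R) + Real.posLog ‖x - ζ‖⁻¹) := by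
      rw [Real.posLog_eq_log_max_one (by positivity), Real.exp_add,
        Real.exp_log (by positivity), Real.exp_log (by positivity)]
      have h2 : ‖z - ζ‖ ≤ R + ‖x - ζ‖ := by
        refine le_trans ?_ (add_le_add_left hR _)
        simpa using norm_add_le (z - x) (x - ζ)
      have h3 : 1 ≤ ‖x - ζ‖ * max 1 ‖x - ζ‖⁻¹ := by
        calc 1 = ‖x - ζ‖ * ‖x - ζ‖⁻¹ := (mul_inv_cancel₀ hpos.ne').symm
          _ ≤ _ := by gcongr; exact le_max_right _ _
      have h4 : ‖x - ζ‖ ≤ ‖x - ζ‖ * max 1 ‖x - ζ‖⁻¹ :=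
        le_mul_of_one_le_right hpos.le (le_max_left _ _)
      nlinarith [mul_le_mul_of_nonneg_left h3 hR0]
    simp only [Multiset.map_cons, Multiset.prod_cons, Multiset.card_cons, Multiset.sum_cons]
    calc _ ≤ (‖x - ζ‖ * Real.exp (Real.log (1 + R) + Real.posLog ‖x - ζ‖⁻¹)) * _ :=
          mul_le_mul h1 (ih hx.2) (Multiset.prod_nonneg (by simp +contextual))
            (by positivity)
      _ = _ := by
          push_cast
          rw [mul_mul_mul_comm, ← Real.exp_add]
          congr 2
          ring

open MeasureTheory in
theorem lintegral_multisetSum_posLog_le {ν : Measure ℂ} {M : ℝ≥0∞}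
    (hM : ∀ ζ, ∫⁻ z, ENNReal.ofReal (Real.posLog ‖z - ζ‖⁻¹) ∂ν ≤ M) (s : Multiset ℂ) :
    ∫⁻ x, ENNReal.ofReal (s.map fun ζ => Real.posLog ‖x - ζ‖⁻¹).sum ∂ν ≤ s.card * M := by
  induction s using Multiset.induction with
  | empty => simp
  | cons ζ s ih =>
    have hm : Measurable fun x : ℂ => ENNReal.ofReal (Real.posLog ‖x - ζ‖⁻¹) :=
      ENNReal.measurable_ofReal.comp (Real.continuous_posLog.measurable.comp
        (measurable_id.sub measurable_const).norm.inv)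
    have h1 : ∀ x : ℂ, ENNReal.ofReal ((ζ ::ₘ s).map fun ζ => Real.posLog ‖x - ζ‖⁻¹).sum =
        ENNReal.ofReal (Real.posLog ‖x - ζ‖⁻¹) +
          ENNReal.ofReal (s.map fun ζ => Real.posLog ‖x - ζ‖⁻¹).sum := fun x => by
      rw [Multiset.map_cons, Multiset.sum_cons, ENNReal.ofReal_add Real.posLog_nonneg]
      refine Multiset.sum_nonneg fun y hy => ?_
      obtain ⟨ζ, -, rfl⟩ := Multiset.mem_map.1 hy
      exact Real.posLog_nonneg
    simp_rw [h1]
    rw [lintegral_add_left hm, Multiset.card_cons, Nat.cast_succ, add_mul, one_mul, add_comm]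
    exact add_le_add ih (hM ζ)

open MeasureTheory in
/-- The values of `p` at `z` and at `x` are compared through the roots of `p`; the loss is
controlled by the sum over the roots `ζ` of the `log⁺ ‖x - ζ‖⁻¹`, whose mean with respect to `ν` is at
most `M` times the degree, so that some `x ∈ F` does at least as well. -/
theorem exists_polynomial_bound_of_potential {F : Set ℂ} (hF : IsCompact F) {ν : Measure ℂ}
    [IsProbabilityMeasure ν] (hν : ν Fᶜ = 0) (hatom : ∀ z, ν {z} = 0) {M : ℝ≥0∞} (hMt : M ≠ ⊤)
    (hM : ∀ ζ, ∫⁻ z, ENNReal.ofReal (Real.posLog ‖z - ζ‖⁻¹) ∂ν ≤ M) (z : ℂ) :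
    ∃ C : ℝ, 1 ≤ C ∧ ∀ (p : Polynomial ℂ) (D : ℕ) (B : ℝ), p.natDegree ≤ D → 0 ≤ B →
      (∀ x ∈ F, ‖p.eval x‖ ≤ B) → ‖p.eval z‖ ≤ B * C ^ D := by
  obtain ⟨R, hR0, hR⟩ : ∃ R : ℝ, 0 ≤ R ∧ ∀ x ∈ F, ‖z - x‖ ≤ R := by
    obtain ⟨R, hR⟩ := hF.isBounded.subset_closedBall z
    refine ⟨max R 0, le_max_right _ _, fun x hx => ?_⟩
    rw [← dist_eq_norm, dist_comm]
    exact (hR hx).trans (le_max_left _ _)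
  set a : ℝ := Real.log (1 + R) + M.toReal
  have ha : 0 ≤ a := add_nonneg (Real.log_nonneg (by linarith)) ENNReal.toReal_nonneg
  refine ⟨Real.exp a, Real.one_le_exp ha, fun p D B hp hB hpB => ?_⟩
  rcases eq_or_ne p 0 with rfl | hp0
  · simp only [Polynomial.eval_zero, norm_zero]; positivity
  have hm : Measurable fun x : ℂ =>
      ENNReal.ofReal (p.roots.map fun ζ => Real.posLog ‖x - ζ‖⁻¹).sum := by
    refine ENNReal.measurable_ofReal.comp ?_
    induction p.roots using Multiset.induction with
    | empty => simp
    | cons ζ s ih =>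
      simp only [Multiset.map_cons, Multiset.sum_cons]
      exact (Real.continuous_posLog.measurable.comp
        (measurable_id.sub measurable_const).norm.inv).add ih
  have hnull : ν (Fᶜ ∪ (p.roots.toFinset : Set ℂ)) = 0 := by
    rw [measure_union_null_iff]
    refine ⟨hν, ?_⟩
    rw [← Set.biUnion_of_singleton (p.roots.toFinset : Set ℂ)]
    exact (measure_biUnion_null_iff p.roots.toFinset.countable_toSet).2 fun x _ => hatom x
  obtain ⟨x, hxN, hx⟩ := exists_notMem_null_le_lintegral hm.aemeasurable hnull
  simp only [Set.mem_union, Set.mem_compl_iff, not_or, not_not, Finset.mem_coe,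
    Multiset.mem_toFinset] at hxN
  have hx' := hx.trans (lintegral_multisetSum_posLog_le hM p.roots)
  have hsum : (p.roots.map fun ζ => Real.posLog ‖x - ζ‖⁻¹).sum ≤ p.roots.card * M.toReal := by
    have h := ENNReal.toReal_mono (by finiteness) hx'
    rw [ENNReal.toReal_mul, ENNReal.toReal_natCast] at h
    exact ENNReal.ofReal_le_iff_le_toReal (by finiteness) |>.1 hx' |>.trans (by simp)
  have heval : ∀ y, ‖p.eval y‖ = ‖p.leadingCoeff‖ * (p.roots.map fun ζ => ‖y - ζ‖).prod := by
    intro y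
    rw [(IsAlgClosed.splits p).eval_eq_prod_roots y, norm_mul]
    congr 1
    have := map_multiset_prod (normHom : ℂ →*₀ ℝ) (p.roots.map fun ζ => y - ζ)
    simpa [Multiset.map_map, Function.comp_def] using this
  have hcard : (p.roots.card : ℝ) ≤ D := by
    exact_mod_cast (Polynomial.card_roots' p).trans hp
  calc ‖p.eval z‖ = ‖p.leadingCoeff‖ * (p.roots.map fun ζ => ‖z - ζ‖).prod := heval z
    _ ≤ ‖p.leadingCoeff‖ * ((p.roots.map fun ζ => ‖x - ζ‖).prod * Real.exp (p.roots.card *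
          Real.log (1 + R) + (p.roots.map fun ζ => Real.posLog ‖x - ζ‖⁻¹).sum)) := by
        gcongr
        exact prod_norm_sub_le _ hxN.2 (hR x hxN.1)
    _ = ‖p.eval x‖ * Real.exp (p.roots.card *
          Real.log (1 + R) + (p.roots.map fun ζ => Real.posLog ‖x - ζ‖⁻¹).sum) := by
        rw [heval x, mul_assoc]
    _ ≤ B * Real.exp (D * a) := by
        gcongr
        · exact hpB x hxN.1
        · calc _ ≤ p.roots.card * Real.log (1 + R) + p.roots.card * M.toReal := by gcongr
            _ = p.roots.card * a := by ring
            _ ≤ D * a := by gcongr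
    _ = B * Real.exp a ^ D := by rw [Real.exp_nat_mul]

/-- A form of the Bernstein–Walsh inequality, uniform in the polynomial: `C` depends only on `A k`
and on `z`. -/
theorem bernstein_walsh {S : Set ℂ} (hS : 0 < logCapacity S) {A : ℕ → Set ℂ}
    (hA : ∀ k, IsClosed (A k)) (hSA : S ⊆ ⋃ k, A k) :
    ∃ k : ℕ, ∀ z : ℂ, ∃ C : ℝ, 1 ≤ C ∧ ∀ (p : Polynomial ℂ) (D : ℕ) (B : ℝ),
      p.natDegree ≤ D → 0 ≤ B → (∀ x ∈ A k, ‖p.eval x‖ ≤ B) → ‖p.eval z‖ ≤ B * C ^ D := by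
  obtain ⟨k, F, ν, M, hFA, hF, hν, hνF, hatom, hMt, hM⟩ :=
    exists_measure_bounded_potential hS hA hSA
  refine ⟨k, fun z => ?_⟩
  obtain ⟨C, hC, h⟩ := exists_polynomial_bound_of_potential hF hνF hatom hMt hM z
  exact ⟨C, hC, fun p D B hp hB hpB => h p D B hp hB fun x hx => hpB x (hFA hx)⟩


theorem logCapacity_mono {S T : Set ℂ} (h : S ⊆ T) : logCapacity S ≤ logCapacity T := by
  refine sSup_le_sSup ?_
  rintro c ⟨μ, K, h1, h2, h3, h4, h5⟩
  exact ⟨μ, K, h1, h2, h3, h4.trans h, h5⟩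

theorem gammaProjection_mono {k : ℕ} {E F : Set (Fin (k + 1) → ℂ)} (h : E ⊆ F) :
    gammaProjection E ⊆ gammaProjection F := fun _ hz =>
  lt_of_lt_of_le hz (logCapacity_mono fun _ hw => h hw)

theorem gammaProjectionLine_mono (k : ℕ) {E F : Set (Fin (k + 1) → ℂ)} (h : E ⊆ F) :
    gammaProjectionLine k E ⊆ gammaProjectionLine k F := by
  induction k with
  | zero => exact fun w hw => h hw
  | succ k ih => exact ih (gammaProjection_mono h)

/-- The set of parameters at which the polynomials `p α` grow at most geometrically with respect
to the weights `N α`. -/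
def growthSet {ι σ : Type*} (p : ι → MvPolynomial σ ℂ) (N : ι → ℕ) : Set (σ → ℂ) :=
  {t | ∃ K : ℕ, ∀ α, ‖MvPolynomial.eval t (p α)‖ ≤ (K : ℝ) ^ N α}

/-- The one-variable case: geometric growth on a set of positive capacity propagates to the
whole plane. -/
theorem exists_geometric_bound_of_logCapacity_pos {ι : Type*} {q : ι → Polynomial ℂ} {N : ι → ℕ}
    {C : ℕ} (hq : ∀ α, (q α).natDegree ≤ C * N α)
    (h : 0 < logCapacity {w | ∃ K : ℕ, ∀ α, ‖(q α).eval w‖ ≤ (K : ℝ) ^ N α}) (z : ℂ) :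
    ∃ K : ℕ, ∀ α, ‖(q α).eval z‖ ≤ (K : ℝ) ^ N α := by
  obtain ⟨K, hK⟩ := bernstein_walsh h
    (A := fun K : ℕ => {w | ∀ α, ‖(q α).eval w‖ ≤ (K : ℝ) ^ N α})
    (fun K => by
      simp only [Set.ofPred_forall]
      exact isClosed_iInter fun α => isClosed_le (q α).continuous.norm continuous_const)
    (fun w hw => Set.mem_iUnion.2 hw)
  obtain ⟨B, hB, hbound⟩ := hK z
  obtain ⟨L, hL⟩ := exists_nat_ge ((K : ℝ) * B ^ C)
  refine ⟨L, fun α => ?_⟩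
  calc _ ≤ (K : ℝ) ^ N α * B ^ (C * N α) :=
        hbound (q α) _ _ (hq α) (by positivity) fun x hx => hx α
    _ = (K * B ^ C) ^ N α := by rw [mul_pow, pow_mul]
    _ ≤ _ := by gcongr

theorem totalDegree_aeval_le {σ τ : Type*} (p : MvPolynomial σ ℂ) {g : σ → MvPolynomial τ ℂ}
    (hg : ∀ i, (g i).totalDegree ≤ 1) : (MvPolynomial.aeval g p).totalDegree ≤ p.totalDegree := by
  rw [MvPolynomial.aeval_def, MvPolynomial.eval₂]
  refine MvPolynomial.totalDegree_finsetSum_le fun d hd => ?_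
  rw [MvPolynomial.algebraMap_eq]
  refine (MvPolynomial.totalDegree_mul _ _).trans ?_
  rw [MvPolynomial.totalDegree_C, zero_add]
  refine (MvPolynomial.totalDegree_finsetProd _ _).trans ?_
  refine le_trans (Finset.sum_le_sum fun i _ => ?_) (MvPolynomial.le_totalDegree hd)
  exact (MvPolynomial.totalDegree_pow _ _).trans (by nlinarith [hg i])

theorem eval_polynomialAeval {σ : Type*} (p : MvPolynomial σ ℂ) (g : σ → Polynomial ℂ) (w : ℂ) :
    (MvPolynomial.aeval g p).eval w = MvPolynomial.eval (fun i => (g i).eval w) p := by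
  induction p using MvPolynomial.induction_on with
  | C a => simp
  | add p q hp hq => simp [hp, hq]
  | mul_X p i hp => simp [hp]

theorem eval_mvPolynomialAeval {σ τ : Type*} (p : MvPolynomial σ ℂ) (g : σ → MvPolynomial τ ℂ)
    (w : τ → ℂ) : MvPolynomial.eval w (MvPolynomial.aeval g p) =
      MvPolynomial.eval (fun i => MvPolynomial.eval w (g i)) p := by
  induction p using MvPolynomial.induction_on with
  | C a => simp
  | add p q hp hq => simp only [map_add, hp, hq]
  | mul_X p i hp => simp only [map_mul, hp, MvPolynomial.aeval_X, MvPolynomial.eval_X]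

/-- Over a point of the `Γ`-projection the fibre of the growth set is the whole line, by the
one-variable case. The `Γ`-projection is thus contained in the growth set of the polynomials with
last variable frozen at any value, to which induction applies. -/
theorem mem_growthSet_of_logCapacity_gammaProjectionLine_pos {ι : Type*} {N : ι → ℕ} {C : ℕ}
    (k : ℕ) (p : ι → MvPolynomial (Fin (k + 1)) ℂ) (hp : ∀ α, (p α).totalDegree ≤ C * N α)
    (h : 0 < logCapacity (gammaProjectionLine k (growthSet p N))) (t : Fin (k + 1) → ℂ) :
    t ∈ growthSet p N := by
  induction k with
  | zero =>
    have hev : ∀ α w, (MvPolynomial.aeval (fun _ => Polynomial.X) (p α) : Polynomial ℂ).eval w =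
        MvPolynomial.eval (fun _ => w) (p α) := fun α w => by simp [eval_polynomialAeval]
    obtain ⟨K, hK⟩ := exists_geometric_bound_of_logCapacity_pos
      (q := fun α => MvPolynomial.aeval (fun _ => Polynomial.X) (p α)) (N := N) (C := C)
      (fun α => (MvPolynomial.aeval_natDegree_le _ (hp α) _
        fun _ => Polynomial.natDegree_X_le).trans (by simp))
      (by simp_rw [hev]; exact h) (t 0)
    refine ⟨K, fun α => ?_⟩
    have ht : t = fun _ => t 0 := funext fun i => by rw [Fin.fin_one_eq_zero i]
    rw [ht, ← hev]
    exact hK α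
  | succ k ih =>
    set g : Fin (k + 2) → MvPolynomial (Fin (k + 1)) ℂ :=
      Fin.snoc (α := fun _ => MvPolynomial (Fin (k + 1)) ℂ) MvPolynomial.X
        (MvPolynomial.C (t (Fin.last _))) with hg
    have hgev : ∀ (z : Fin (k + 1) → ℂ) α, MvPolynomial.eval z (MvPolynomial.aeval g (p α)) =
        MvPolynomial.eval (Fin.snoc z (t (Fin.last _)) : Fin (k + 2) → ℂ) (p α) := by
      intro z α
      rw [eval_mvPolynomialAeval]
      congr 2
      funext i
      refine Fin.lastCases ?_ (fun i => ?_) i <;> simp [hg]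
    have hgdeg : ∀ i, (g i).totalDegree ≤ 1 := by
      intro i
      refine Fin.lastCases ?_ (fun i => ?_) i <;> simp [hg]
    have key : gammaProjection (growthSet p N) ⊆
        growthSet (fun α => MvPolynomial.aeval g (p α)) N := by
      intro z hz
      set e : Fin (k + 2) → Polynomial ℂ :=
        Fin.snoc (α := fun _ => Polynomial ℂ) (fun i => Polynomial.C (z i)) Polynomial.X with he
      have hev : ∀ α w, (MvPolynomial.aeval e (p α)).eval w =
          MvPolynomial.eval (Fin.snoc z w : Fin (k + 2) → ℂ) (p α) := by
        intro α w
        rw [eval_polynomialAeval]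
        congr 2
        funext i
        refine Fin.lastCases ?_ (fun i => ?_) i <;> simp [he]
      obtain ⟨K, hK⟩ := exists_geometric_bound_of_logCapacity_pos
        (q := fun α => MvPolynomial.aeval e (p α)) (N := N) (C := C)
        (fun α => (MvPolynomial.aeval_natDegree_le _ (hp α) e (n := 1) (fun i => by
          refine Fin.lastCases ?_ (fun i => ?_) i <;> simp [he])).trans (by simp))
        (by simp_rw [hev]; exact hz) (t (Fin.last _))
      refine ⟨K, fun α => ?_⟩
      rw [hgev, ← hev]
      exact hK α
    obtain ⟨K, hK⟩ := ih (fun α => MvPolynomial.aeval g (p α))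
      (fun α => (totalDegree_aeval_le _ hgdeg).trans (hp α))
      (h.trans_le (logCapacity_mono (gammaProjectionLine_mono k key))) (Fin.init t)
    refine ⟨K, fun α => ?_⟩
    have := hK α
    rwa [hgev, Fin.snoc_init_self] at this

theorem mem_growthSet_of_gammaCapacity_ne_zero {ι : Type*} {N : ι → ℕ} {C m : ℕ}
    (p : ι → MvPolynomial (Fin m) ℂ) (hp : ∀ α, (p α).totalDegree ≤ C * N α)
    (h : gammaCapacity m (growthSet p N) ≠ 0) (t : Fin m → ℂ) : t ∈ growthSet p N := by
  cases m with
  | zero => exact absurd rfl h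
  | succ k =>
    obtain ⟨U, hU⟩ : ∃ U : Matrix.unitaryGroup (Fin (k + 1)) ℂ,
        0 < logCapacity (gammaProjectionLine k ((fun z : Fin (k + 1) → ℂ =>
          (U : Matrix (Fin (k + 1)) (Fin (k + 1)) ℂ) *ᵥ z) '' growthSet p N)) := by
      by_contra! hcon
      exact h (ENNReal.iSup_eq_zero.2 fun U => le_antisymm (hcon U) zero_le)
    set V : Matrix (Fin (k + 1)) (Fin (k + 1)) ℂ := star (U : Matrix _ _ ℂ) with hV
    have hVU : V * (U : Matrix _ _ ℂ) = 1 := Unitary.coe_star_mul_self U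
    set g : Fin (k + 1) → MvPolynomial (Fin (k + 1)) ℂ := fun i =>
      ∑ j, MvPolynomial.C (V i j) * MvPolynomial.X j with hg
    have hev : ∀ z α, MvPolynomial.eval z (MvPolynomial.aeval g (p α)) =
        MvPolynomial.eval (V *ᵥ z) (p α) := by
      intro z α
      rw [eval_mvPolynomialAeval]
      congr 2
      funext i
      simp [hg, Matrix.mulVec, dotProduct]
    have hgdeg : ∀ i, (g i).totalDegree ≤ 1 := fun i =>
      MvPolynomial.totalDegree_finsetSum_le fun j _ =>
        (MvPolynomial.totalDegree_mul _ _).trans (by simp)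
    have hsub : (fun z : Fin (k + 1) → ℂ => (U : Matrix _ _ ℂ) *ᵥ z) '' growthSet p N ⊆
        growthSet (fun α => MvPolynomial.aeval g (p α)) N := by
      rintro _ ⟨z, ⟨K, hK⟩, rfl⟩
      refine ⟨K, fun α => ?_⟩
      rw [hev, Matrix.mulVec_mulVec, hVU, Matrix.one_mulVec]
      exact hK α
    obtain ⟨K, hK⟩ := mem_growthSet_of_logCapacity_gammaProjectionLine_pos k
      (fun α => MvPolynomial.aeval g (p α))
      (fun α => (totalDegree_aeval_le _ hgdeg).trans (hp α))
      (hU.trans_le (logCapacity_mono (gammaProjectionLine_mono k hsub)))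
      ((U : Matrix _ _ ℂ) *ᵥ t)
    refine ⟨K, fun α => ?_⟩
    have := hK α
    rwa [hev, Matrix.mulVec_mulVec, hVU, Matrix.one_mulVec] at this

end

/-! ### Convergent power series -/

section

open MvPowerSeries

theorem summable_geometric_degree (n : ℕ) {r : ℝ} (h0 : 0 ≤ r) (h1 : r < 1) :
    Summable fun Q : Fin n →₀ ℕ => r ^ Q.degree := by
  refine summable_of_sum_le (c := ((1 - r)⁻¹) ^ n) (fun Q => by positivity) fun s => ?_
  set M := s.sup fun Q => Q.degree with hM
  have hsub : s.map Finsupp.equivFunOnFinite.toEmbedding ⊆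
      Fintype.piFinset fun _ : Fin n => Finset.range (M + 1) := by
    intro q hq
    obtain ⟨Q, hQ, rfl⟩ := Finset.mem_map.1 hq
    rw [Fintype.mem_piFinset]
    intro i
    rw [Finset.mem_range, Nat.lt_succ_iff]
    exact (Finsupp.le_degree i Q).trans (Finset.le_sup (f := fun Q => Q.degree) hQ)
  calc ∑ Q ∈ s, r ^ Q.degree
      = ∑ q ∈ s.map Finsupp.equivFunOnFinite.toEmbedding, ∏ i, r ^ q i := by
        rw [Finset.sum_map]
        refine Finset.sum_congr rfl fun Q _ => ?_
        rw [Finset.prod_pow_eq_pow_sum, Finsupp.degree_eq_sum]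
        rfl
    _ ≤ ∑ q ∈ Fintype.piFinset fun _ : Fin n => Finset.range (M + 1), ∏ i, r ^ q i :=
        Finset.sum_le_sum_of_subset_of_nonneg hsub fun q _ _ => by positivity
    _ = ∏ _i : Fin n, ∑ j ∈ Finset.range (M + 1), r ^ j :=
        (Finset.prod_univ_sum (fun _ => Finset.range (M + 1)) fun _ j => r ^ j).symm
    _ ≤ ∏ _i : Fin n, (1 - r)⁻¹ := by
        refine Finset.prod_le_prod (fun _ _ => Finset.sum_nonneg fun _ _ => by positivity)
          fun _ _ => ?_
        rw [← tsum_geometric_of_lt_one h0 h1]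
        exact (summable_geometric_of_lt_one h0 h1).sum_le_tsum _ fun _ _ => by positivity
    _ = _ := by simp

theorem summable_norm_coeff_mul {n : ℕ} {F G : MvPowerSeries (Fin n) ℂ} {r : ℝ} (hr : 0 ≤ r)
    (hF : Summable fun Q : Fin n →₀ ℕ => ‖coeff Q F‖ * r ^ Q.degree)
    (hG : Summable fun Q : Fin n →₀ ℕ => ‖coeff Q G‖ * r ^ Q.degree) :
    Summable fun Q : Fin n →₀ ℕ => ‖coeff Q (F * G)‖ * r ^ Q.degree := by
  set f : (Fin n →₀ ℕ) → ℝ := fun Q => ‖coeff Q F‖ * r ^ Q.degree with hf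
  set g : (Fin n →₀ ℕ) → ℝ := fun Q => ‖coeff Q G‖ * r ^ Q.degree with hg
  have hfg : Summable fun x : (Fin n →₀ ℕ) × (Fin n →₀ ℕ) => f x.1 * g x.2 :=
    Summable.mul_of_nonneg hF hG (fun Q => by positivity) fun Q => by positivity
  have h := summable_sum_mul_antidiagonal_of_summable_mul hfg
  refine h.of_nonneg_of_le (fun Q => by positivity) fun Q => ?_
  rw [coeff_mul]
  calc _ ≤ (∑ p ∈ Finset.HasAntidiagonal.antidiagonal Q, ‖coeff p.1 F‖ * ‖coeff p.2 G‖) *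
        r ^ Q.degree := by
        gcongr
        exact (norm_sum_le _ _).trans (Finset.sum_le_sum fun p _ => norm_mul_le _ _)
    _ = _ := by
        rw [Finset.sum_mul]
        refine Finset.sum_congr rfl fun p hp => ?_
        rw [← Finset.HasAntidiagonal.mem_antidiagonal.1 hp, map_add, pow_add]
        simp only [hf, hg]
        ring

/-- The algebra of the power series whose terms are absolutely summable on the closed polydisc of
radius `ρ`. -/
def absConvergent (n : ℕ) (ρ : NNReal) : Subalgebra ℂ (MvPowerSeries (Fin n) ℂ) where
  carrier := {F | Summable fun Q : Fin n →₀ ℕ => ‖coeff Q F‖ * (ρ : ℝ) ^ Q.degree}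
  add_mem' {F G} hF hG := by
    change Summable _ at hF hG ⊢
    refine (hF.add hG).of_nonneg_of_le (fun Q => by positivity) fun Q => ?_
    rw [map_add, ← add_mul]
    gcongr
    exact norm_add_le _ _
  mul_mem' hF hG := summable_norm_coeff_mul ρ.2 hF hG
  algebraMap_mem' a := by
    refine summable_of_ne_finset_zero (s := {0}) fun Q hQ => ?_
    rw [Finset.mem_singleton] at hQ
    simp [MvPowerSeries.algebraMap_apply, coeff_C, hQ]

variable {n : ℕ}

theorem mem_absConvergent {F : MvPowerSeries (Fin n) ℂ} {ρ : NNReal} :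
    F ∈ absConvergent n ρ ↔ Summable fun Q : Fin n →₀ ℕ => ‖coeff Q F‖ * (ρ : ℝ) ^ Q.degree :=
  Iff.rfl

theorem absConvergent_anti {ρ ρ' : NNReal} (h : ρ' ≤ ρ) :
    absConvergent n ρ ≤ absConvergent n ρ' := fun F hF =>
  (mem_absConvergent.1 hF).of_nonneg_of_le (fun Q => by positivity) fun Q => by gcongr

theorem norm_seriesTerm_le {F : MvPowerSeries (Fin n) ℂ} {z : Fin n → ℂ} {r : ℝ}
    (hz : ‖z‖ ≤ r) (Q : Fin n →₀ ℕ) : ‖seriesTerm F z Q‖ ≤ ‖coeff Q F‖ * r ^ Q.degree := by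
  rw [seriesTerm, norm_mul, norm_prod, Finsupp.degree_eq_sum, ← Finset.prod_pow_eq_pow_sum]
  gcongr with k
  rw [norm_pow]
  gcongr
  exact (norm_le_pi_norm z k).trans hz

theorem summable_norm_seriesTerm {F : MvPowerSeries (Fin n) ℂ} {ρ : NNReal}
    (hF : F ∈ absConvergent n ρ) {z : Fin n → ℂ} (hz : ‖z‖ ≤ ρ) :
    Summable fun Q => ‖seriesTerm F z Q‖ :=
  (mem_absConvergent.1 hF).of_nonneg_of_le (fun _ => norm_nonneg _) fun Q => norm_seriesTerm_le hz Q

theorem convergesOnPolydisc_of_mem {F : MvPowerSeries (Fin n) ℂ} {ρ : NNReal}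
    (hF : F ∈ absConvergent n ρ) : ConvergesOnPolydisc F ρ := fun _ hz =>
  (summable_norm_seriesTerm hF (mem_ball_zero_iff.1 hz).le).of_norm

theorem mem_absConvergent_of_convergesOnPolydisc {F : MvPowerSeries (Fin n) ℂ} {r : ℝ}
    (hF : ConvergesOnPolydisc F r) {ρ : NNReal} (hρ : ρ < r) : F ∈ absConvergent n ρ := by
  have h := (hF (fun _ => ((ρ : ℝ) : ℂ)) (by
    rw [mem_ball_zero_iff]
    exact (pi_norm_const_le _).trans_lt (by simpa using hρ))).norm
  refine h.congr fun Q => ?_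
  rw [seriesTerm, norm_mul, norm_prod, Finsupp.degree_eq_sum, ← Finset.prod_pow_eq_pow_sum]
  simp

theorem exists_mem_absConvergent {F : MvPowerSeries (Fin n) ℂ} (hF : IsConvergentSeries F) :
    ∃ ρ : NNReal, 0 < ρ ∧ F ∈ absConvergent n ρ := by
  obtain ⟨r, hr, h⟩ := hF
  refine ⟨(r / 2).toNNReal, by simpa using hr,
    mem_absConvergent_of_convergesOnPolydisc h ?_⟩
  rw [Real.coe_toNNReal _ (by linarith)]
  linarith

/-- Finitely many convergent series converge absolutely on a common closed polydisc. -/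
theorem exists_common_absConvergent {ι : Type*} [Finite ι] {F : ι → MvPowerSeries (Fin n) ℂ}
    (hF : ∀ i, IsConvergentSeries (F i)) :
    ∃ ρ : NNReal, 0 < ρ ∧ ∀ i, F i ∈ absConvergent n ρ := by
  cases nonempty_fintype ι
  choose ρ hρ h using fun i => exists_mem_absConvergent (hF i)
  rcases isEmpty_or_nonempty ι with hι | hι
  · exact ⟨1, one_pos, fun i => isEmptyElim i⟩
  · refine ⟨Finset.univ.inf' Finset.univ_nonempty ρ, ?_, fun i => ?_⟩
    · exact (Finset.lt_inf'_iff _).2 fun i _ => hρ i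
    · exact absConvergent_anti (Finset.inf'_le _ (Finset.mem_univ i)) (h i)

theorem isConvergentSeries_of_mem {F : MvPowerSeries (Fin n) ℂ} {ρ : NNReal} (hρ : 0 < ρ)
    (hF : F ∈ absConvergent n ρ) : IsConvergentSeries F :=
  ⟨ρ, by exact_mod_cast hρ, convergesOnPolydisc_of_mem hF⟩

/-- Convergence of finitely many series is a geometric bound on their coefficients. The exponent
`Q.degree + 1` leaves room for a constant factor. -/
theorem forall_isConvergentSeries_iff_geometric_bound {ι : Type*} [Finite ι]
    {F : ι → MvPowerSeries (Fin n) ℂ} :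
    (∀ i, IsConvergentSeries (F i)) ↔
      ∃ K : ℕ, ∀ i Q, ‖coeff Q (F i)‖ ≤ (K : ℝ) ^ (Q.degree + 1) := by
  constructor
  · intro h
    cases nonempty_fintype ι
    obtain ⟨ρ, hρ, hmem⟩ := exists_common_absConvergent h
    obtain ⟨K, hK⟩ := exists_nat_ge (max (ρ : ℝ)⁻¹
      (∑ i, ∑' Q : Fin n →₀ ℕ, ‖coeff Q (F i)‖ * (ρ : ℝ) ^ Q.degree))
    refine ⟨K, fun i Q => ?_⟩
    have hρ' : (0 : ℝ) < ρ := by exact_mod_cast hρ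
    have h1 : ‖coeff Q (F i)‖ * (ρ : ℝ) ^ Q.degree ≤ K := by
      refine le_trans ?_ ((le_max_right _ _).trans hK)
      refine ((mem_absConvergent.1 (hmem i)).le_tsum Q fun _ _ => by positivity).trans ?_
      exact Finset.single_le_sum (f := fun i => ∑' Q : Fin n →₀ ℕ,
        ‖coeff Q (F i)‖ * (ρ : ℝ) ^ Q.degree) (fun i _ => tsum_nonneg fun Q => by positivity)
        (Finset.mem_univ i)
    have h2 : (ρ : ℝ)⁻¹ ≤ K := (le_max_left _ _).trans hK
    calc ‖coeff Q (F i)‖ = (‖coeff Q (F i)‖ * (ρ : ℝ) ^ Q.degree) * (ρ : ℝ)⁻¹ ^ Q.degree := by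
          rw [mul_assoc, ← mul_pow, mul_inv_cancel₀ hρ'.ne', one_pow, mul_one]
      _ ≤ K * (K : ℝ) ^ Q.degree := by gcongr
      _ = _ := by rw [pow_succ']
  · rintro ⟨K, hK⟩ i
    set ρ : NNReal := (2 * (K + 1))⁻¹ with hρ
    have hρ0 : 0 < ρ := by positivity
    refine isConvergentSeries_of_mem hρ0 ?_
    have h1 := (summable_geometric_degree n (r := 1 / 2) (by norm_num) (by norm_num)).mul_left (K : ℝ)
    refine mem_absConvergent.2 (h1.of_nonneg_of_le (fun Q => by positivity) fun Q => ?_)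
    calc ‖coeff Q (F i)‖ * (ρ : ℝ) ^ Q.degree ≤ (K : ℝ) ^ (Q.degree + 1) * (ρ : ℝ) ^ Q.degree := by
          gcongr; exact hK i Q
      _ = K * (K * ρ) ^ Q.degree := by rw [pow_succ', mul_assoc, mul_pow]
      _ ≤ K * (1 / 2) ^ Q.degree := by
          gcongr
          rw [hρ]
          push_cast
          rw [← div_eq_mul_inv, div_le_div_iff₀ (by positivity) (by positivity)]
          linarith

theorem seriesTerm_add (F G : MvPowerSeries (Fin n) ℂ) (z : Fin n → ℂ) (Q : Fin n →₀ ℕ) :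
    seriesTerm (F + G) z Q = seriesTerm F z Q + seriesTerm G z Q := by
  rw [seriesTerm, map_add, add_mul]; rfl

theorem seriesTerm_mul (F G : MvPowerSeries (Fin n) ℂ) (z : Fin n → ℂ) (Q : Fin n →₀ ℕ) :
    seriesTerm (F * G) z Q =
      ∑ p ∈ Finset.HasAntidiagonal.antidiagonal Q, seriesTerm F z p.1 * seriesTerm G z p.2 := by
  rw [seriesTerm, coeff_mul, Finset.sum_mul]
  refine Finset.sum_congr rfl fun p hp => ?_
  rw [← Finset.HasAntidiagonal.mem_antidiagonal.1 hp, seriesTerm, seriesTerm, mul_mul_mul_comm,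
    ← Finset.prod_mul_distrib]
  simp [pow_add]

theorem seriesSum_C (a : ℂ) (z : Fin n → ℂ) : seriesSum (C a) z = a := by
  rw [seriesSum, tsum_eq_single 0]
  · simp [seriesTerm]
  · intro Q hQ
    simp [seriesTerm, coeff_C, hQ]

/-- Evaluation at a point of the closed polydisc of radius `ρ`. -/
def evalHom {ρ : NNReal} (z : Fin n → ℂ) (hz : ‖z‖ ≤ ρ) : absConvergent n ρ →ₐ[ℂ] ℂ where
  toFun F := seriesSum F.1 z
  map_one' := by simpa using seriesSum_C (n := n) 1 z
  map_zero' := by simpa using seriesSum_C (n := n) 0 z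
  map_add' F G := by
    simp only [seriesSum, Subalgebra.coe_add, seriesTerm_add]
    exact (summable_norm_seriesTerm F.2 hz).of_norm.tsum_add
      (summable_norm_seriesTerm G.2 hz).of_norm
  map_mul' F G := by
    have hF := summable_norm_seriesTerm F.2 hz
    have hG := summable_norm_seriesTerm G.2 hz
    simp only [seriesSum, Subalgebra.coe_mul, seriesTerm_mul]
    exact (hF.of_norm.tsum_mul_tsum_eq_tsum_sum_antidiagonal hG.of_norm
      (summable_mul_of_summable_norm hF hG)).symm
  commutes' a := seriesSum_C a z

theorem evalHom_apply {ρ : NNReal} {z : Fin n → ℂ} (hz : ‖z‖ ≤ ρ) (F : absConvergent n ρ) :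
    evalHom z hz F = seriesSum F.1 z := rfl

/-- A power series of order at least `N` is `O(‖z‖ ^ N)`. -/
theorem exists_norm_seriesSum_le_pow {F : MvPowerSeries (Fin n) ℂ} {ρ : NNReal} (hρ : 0 < ρ)
    (hF : F ∈ absConvergent n ρ) {N : ℕ} (hN : (N : ℕ∞) ≤ F.order) :
    ∃ A : ℝ, ∀ z : Fin n → ℂ, ‖z‖ ≤ ρ → ‖seriesSum F z‖ ≤ A * ‖z‖ ^ N := by
  have hρ' : (0 : ℝ) < ρ := by exact_mod_cast hρ
  refine ⟨(∑' Q : Fin n →₀ ℕ, ‖coeff Q F‖ * (ρ : ℝ) ^ Q.degree) * ((ρ : ℝ)⁻¹) ^ N,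
    fun z hz => ?_⟩
  have hsum := (mem_absConvergent.1 hF).mul_right (((ρ : ℝ)⁻¹) ^ N * ‖z‖ ^ N)
  rw [mul_assoc, ← tsum_mul_right]
  refine tsum_of_norm_bounded hsum.hasSum fun Q => ?_
  rcases lt_or_ge Q.degree N with h | h
  · rw [seriesTerm, coeff_of_lt_order (lt_of_lt_of_le (by exact_mod_cast h) hN)]
    simp
  · refine (norm_seriesTerm_le le_rfl Q).trans ?_
    rw [mul_assoc]
    gcongr
    obtain ⟨e, he⟩ := Nat.exists_eq_add_of_le h
    rw [he, pow_add, pow_add]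
    calc ‖z‖ ^ N * ‖z‖ ^ e ≤ ‖z‖ ^ N * (ρ : ℝ) ^ e := by gcongr
      _ = (ρ : ℝ) ^ N * (ρ : ℝ) ^ e * ((ρ : ℝ)⁻¹ ^ N * ‖z‖ ^ N) := by
        rw [inv_pow]; field_simp

end

/-! ### Differentiation of convergent power series -/

section

open MvPowerSeries

variable {n : ℕ}

theorem succ_mul_pow_le {a b : ℝ} (ha : 0 ≤ a) (hab : a < b) (m : ℕ) :
    (m + 1) * a ^ m ≤ (b - a)⁻¹ * b ^ (m + 1) := by
  have key : ∀ m : ℕ, (m + 1) * a ^ m * (b - a) + a ^ (m + 1) ≤ b ^ (m + 1) := by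
    intro m
    induction m with
    | zero => simp
    | succ m ih =>
      have h1 : 0 ≤ (m + 1) * a ^ m * (b - a) ^ 2 := by positivity
      have h2 := mul_le_mul_of_nonneg_left ih (ha.trans hab.le)
      have h3 : b * b ^ (m + 1) = b ^ (m + 1 + 1) := by ring
      rw [← h3]
      refine le_trans ?_ h2
      push_cast
      ring_nf at h1 ⊢
      linarith
  rw [inv_mul_eq_div, le_div_iff₀ (sub_pos.2 hab)]
  have := key m
  have : 0 ≤ a ^ (m + 1) := by positivity
  linarith [key m]

theorem mul_pow_pred_le {a b : ℝ} (ha : 0 ≤ a) (hab : a < b) (m : ℕ) :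
    m * a ^ (m - 1) ≤ (b - a)⁻¹ * b ^ m := by
  cases m with
  | zero => simpa using hab.le
  | succ m => simpa using succ_mul_pow_le ha hab m

/-- A formal partial derivative converges absolutely on any smaller polydisc. -/
theorem pderiv_mem_absConvergent {F : MvPowerSeries (Fin n) ℂ} {ρ ρ' : NNReal}
    (hF : F ∈ absConvergent n ρ) (h : ρ' < ρ) (k : Fin n) :
    pderiv ℂ k F ∈ absConvergent n ρ' := by
  have h' : (ρ' : ℝ) < ρ := by exact_mod_cast h
  have hinj : Function.Injective fun Q : Fin n →₀ ℕ => Q + Finsupp.single k 1 :=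
    add_left_injective _
  have hs := ((mem_absConvergent.1 hF).comp_injective hinj).mul_left ((ρ : ℝ) - ρ')⁻¹
  refine mem_absConvergent.2 (hs.of_nonneg_of_le (fun Q => by positivity) fun Q => ?_)
  have h1 : ‖(Q k : ℂ) + 1‖ ≤ (Q.degree : ℝ) + 1 := by
    have : ‖(Q k : ℂ) + 1‖ = (Q k : ℝ) + 1 := by
      exact_mod_cast Complex.norm_natCast (Q k + 1)
    rw [this]
    gcongr
    exact Finsupp.le_degree k Q
  rw [coeff_pderiv, norm_mul, Function.comp_apply, map_add, Finsupp.degree_single]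
  calc _ ≤ ‖coeff (Q + Finsupp.single k 1) F‖ * ((Q.degree + 1) * (ρ' : ℝ) ^ Q.degree) := by
        rw [mul_assoc]; gcongr
    _ ≤ ‖coeff (Q + Finsupp.single k 1) F‖ * (((ρ : ℝ) - ρ')⁻¹ * (ρ : ℝ) ^ (Q.degree + 1)) := by
        exact mul_le_mul_of_nonneg_left (succ_mul_pow_le ρ'.2 h' _) (norm_nonneg _)
    _ = _ := by ring

/-- The derivative of a term of a power series in the direction of the `k`-th coordinate. -/
def termDeriv (F : MvPowerSeries (Fin n) ℂ) (k : Fin n) (z : Fin n → ℂ) (Q : Fin n →₀ ℕ) : ℂ :=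
  coeff Q F * ((∏ j ∈ Finset.univ.erase k, z j ^ Q j) * ((Q k : ℂ) * z k ^ (Q k - 1)))

theorem hasFDerivAt_seriesTerm (F : MvPowerSeries (Fin n) ℂ) (z : Fin n → ℂ) (Q : Fin n →₀ ℕ) :
    HasFDerivAt (fun z => seriesTerm F z Q)
      (∑ k, termDeriv F k z Q • (ContinuousLinearMap.proj k : (Fin n → ℂ) →L[ℂ] ℂ)) z := by
  have h : ∀ k ∈ Finset.univ, HasFDerivAt (fun z : Fin n → ℂ => z k ^ Q k)
      (((Q k : ℂ) * z k ^ (Q k - 1)) • (ContinuousLinearMap.proj k : (Fin n → ℂ) →L[ℂ] ℂ)) z := by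
    intro k _
    have := (hasFDerivAt_apply (𝕜 := ℂ) k z).pow (Q k)
    simpa using this
  have h2 := (HasFDerivAt.finsetProd h).const_mul (coeff Q F)
  refine h2.congr_fderiv ?_
  rw [Finset.smul_sum]
  refine Finset.sum_congr rfl fun k _ => ?_
  rw [smul_smul, smul_smul, termDeriv, mul_assoc]

theorem norm_termDeriv_le (F : MvPowerSeries (Fin n) ℂ) (k : Fin n) {z : Fin n → ℂ} {r : ℝ}
    (hz : ‖z‖ ≤ r) (Q : Fin n →₀ ℕ) :
    ‖termDeriv F k z Q‖ ≤ ‖coeff Q F‖ * (Q.degree * r ^ (Q.degree - 1)) := by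
  have hr : 0 ≤ r := (norm_nonneg _).trans hz
  rcases Nat.eq_zero_or_pos (Q k) with h0 | h0
  · simp only [termDeriv, h0, Nat.cast_zero, zero_mul, mul_zero, norm_zero]
    positivity
  have hsum : Q.degree - 1 = ∑ j ∈ Finset.univ.erase k, Q j + (Q k - 1) := by
    have := Finset.sum_erase_add Finset.univ (fun j => Q j) (Finset.mem_univ k)
    rw [Finsupp.degree_eq_sum]
    omega
  rw [termDeriv, norm_mul, norm_mul, norm_mul, norm_prod, norm_pow, Complex.norm_natCast]
  refine mul_le_mul_of_nonneg_left ?_ (norm_nonneg _)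
  rw [hsum, pow_add, ← Finset.prod_pow_eq_pow_sum, mul_left_comm]
  gcongr with j
  · exact Finsupp.le_degree k Q
  · rw [norm_pow]
    gcongr
    exact (norm_le_pi_norm z j).trans hz
  · exact (norm_le_pi_norm z k).trans hz

theorem summable_coeff_mul_degree {F : MvPowerSeries (Fin n) ℂ} {ρ : NNReal}
    (hF : F ∈ absConvergent n ρ) {r : ℝ} (hr : 0 ≤ r) (hrρ : r < ρ) :
    Summable fun Q : Fin n →₀ ℕ => ‖coeff Q F‖ * (Q.degree * r ^ (Q.degree - 1)) := by
  refine ((mem_absConvergent.1 hF).mul_left ((ρ : ℝ) - r)⁻¹).of_nonneg_of_le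
    (fun Q => by positivity) fun Q => ?_
  rw [mul_left_comm _ ‖coeff Q F‖]
  exact mul_le_mul_of_nonneg_left (mul_pow_pred_le hr hrρ _) (norm_nonneg (coeff Q F))

theorem tsum_termDeriv (F : MvPowerSeries (Fin n) ℂ) (k : Fin n) (z : Fin n → ℂ) :
    ∑' Q, termDeriv F k z Q = seriesSum (pderiv ℂ k F) z := by
  have hinj : Function.Injective fun Q : Fin n →₀ ℕ => Q + Finsupp.single k 1 :=
    add_left_injective _
  rw [seriesSum, ← hinj.tsum_eq]
  · refine tsum_congr fun Q => ?_
    have hprod : ∏ j ∈ Finset.univ.erase k, z j ^ (Q + Finsupp.single k 1 : Fin n →₀ ℕ) j =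
        ∏ j ∈ Finset.univ.erase k, z j ^ Q j := by
      refine Finset.prod_congr rfl fun j hj => ?_
      rw [Finsupp.add_apply, Finsupp.single_eq_of_ne (Finset.ne_of_mem_erase hj), add_zero]
    rw [termDeriv, seriesTerm, coeff_pderiv, hprod,
      ← Finset.prod_erase_mul Finset.univ (fun j => z j ^ Q j) (Finset.mem_univ k)]
    simp
    ring
  · intro Q hQ
    have hk : Q k ≠ 0 := by
      intro h0
      simp [termDeriv, h0] at hQ
    refine ⟨Q - Finsupp.single k 1, tsub_add_cancel_of_le ?_⟩
    rw [Finsupp.single_le_iff]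
    omega

/-- Termwise differentiation of a convergent power series. -/
theorem hasFDerivAt_seriesSum {F : MvPowerSeries (Fin n) ℂ} {ρ : NNReal}
    (hF : F ∈ absConvergent n ρ) {z : Fin n → ℂ} (hz : ‖z‖ < ρ) :
    HasFDerivAt (seriesSum F)
      (∑ k, seriesSum (pderiv ℂ k F) z • (ContinuousLinearMap.proj k : (Fin n → ℂ) →L[ℂ] ℂ)) z := by
  obtain ⟨r, hzr, hrρ⟩ := exists_between hz
  have hr : 0 ≤ r := (norm_nonneg _).trans hzr.le
  have hs := summable_coeff_mul_degree hF hr hrρ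
  have hproj : ∀ k, ‖(ContinuousLinearMap.proj k : (Fin n → ℂ) →L[ℂ] ℂ)‖ ≤ 1 := fun k =>
    ContinuousLinearMap.opNorm_le_bound _ zero_le_one fun x => by
      simpa using norm_le_pi_norm x k
  have h := hasFDerivAt_tsum_of_isPreconnected (𝕜 := ℂ)
    (f := fun Q z => seriesTerm F z Q) (hs.mul_left (n : ℝ))
    (Metric.isOpen_ball (x := (0 : Fin n → ℂ)) (ε := r)) (convex_ball _ _).isPreconnected
    (fun Q x _ => hasFDerivAt_seriesTerm F x Q)
    (fun Q x hx => by
      refine (norm_sum_le _ _).trans ?_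
      have hx' : ‖x‖ ≤ r := (mem_ball_zero_iff.1 hx).le
      refine (Finset.sum_le_card_nsmul _ _ (‖coeff Q F‖ * (Q.degree * r ^ (Q.degree - 1)))
        fun k _ => ?_).trans (by simp)
      rw [norm_smul]
      exact (mul_le_of_le_one_right (norm_nonneg _) (hproj k)).trans (norm_termDeriv_le F k hx' Q))
    (mem_ball_zero_iff.2 hzr) (summable_norm_seriesTerm hF hz.le).of_norm (mem_ball_zero_iff.2 hzr)
  refine h.congr_fderiv ?_
  have hsk : ∀ k, Summable fun Q => termDeriv F k z Q := fun k =>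
    hs.of_norm_bounded fun Q => norm_termDeriv_le F k hzr.le Q
  rw [Summable.tsum_finsetSum fun k _ => (hsk k).smul_const _]
  refine Finset.sum_congr rfl fun k _ => ?_
  rw [(hsk k).tsum_smul_const, tsum_termDeriv]

theorem contDiffAt_seriesSum {F : MvPowerSeries (Fin n) ℂ} {ρ : NNReal}
    (hF : F ∈ absConvergent n ρ) {z : Fin n → ℂ} (hz : ‖z‖ < ρ) :
    ContDiffAt ℂ 1 (seriesSum F) z := by
  obtain ⟨r, hzr, hrρ⟩ := exists_between hz
  lift r to NNReal using (norm_nonneg _).trans hzr.le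
  refine contDiffAt_one_iff.2 ⟨_, Metric.ball 0 r,
    Metric.isOpen_ball.mem_nhds (mem_ball_zero_iff.2 hzr), ?_,
    fun x hx => hasFDerivAt_seriesSum hF ((mem_ball_zero_iff.1 hx).trans hrρ)⟩
  refine continuousOn_finsetSum _ fun k _ => ContinuousOn.fun_smul (fun x hx => ?_) continuousOn_const
  exact (hasFDerivAt_seriesSum (pderiv_mem_absConvergent hF (by exact_mod_cast hrρ) k)
    (mem_ball_zero_iff.1 hx)).continuousAt.continuousWithinAt

end

/-! ### Formal substitution and orders -/

section

open MvPowerSeries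

variable {n : ℕ} {R : Type*} [CommRing R]

/-- The multi-indices of degree at most `N`. -/
def degreeLE (n N : ℕ) : Finset (Fin n →₀ ℕ) := (Finsupp.finite_of_degree_le N).toFinset

theorem mem_degreeLE {N : ℕ} {Q : Fin n →₀ ℕ} : Q ∈ degreeLE n N ↔ Q.degree ≤ N := by
  simp [degreeLE]

theorem le_order_prod_pow {h : Fin n → MvPowerSeries (Fin n) R}
    (hh : ∀ i, constantCoeff (h i) = 0) (P : Fin n →₀ ℕ) :
    (P.degree : ℕ∞) ≤ (∏ k, h k ^ P k).order := by
  refine le_trans ?_ (le_order_prod _ _)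
  rw [Finsupp.degree_eq_sum]
  push_cast
  exact Finset.sum_le_sum fun k _ => le_order_pow_of_constantCoeff_eq_zero _ (hh k)

theorem coeff_prod_pow_of_lt {h : Fin n → MvPowerSeries (Fin n) R}
    (hh : ∀ i, constantCoeff (h i) = 0) {P Q : Fin n →₀ ℕ} (hPQ : Q.degree < P.degree) :
    coeff Q (∏ k, h k ^ P k) = 0 :=
  coeff_of_lt_order (lt_of_lt_of_le (by exact_mod_cast hPQ) (le_order_prod_pow hh P))

/-- Only the terms of degree at most `N` of `G` contribute to the coefficients of degree at
most `N` of `G ∘ h`. -/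
theorem coeff_subst_eq_sum {h : Fin n → MvPowerSeries (Fin n) R}
    (hh : ∀ i, constantCoeff (h i) = 0) (G : MvPowerSeries (Fin n) R) {N : ℕ} {Q : Fin n →₀ ℕ}
    (hQ : Q.degree ≤ N) :
    coeff Q (subst h G) = ∑ P ∈ degreeLE n N, coeff P G * coeff Q (∏ k, h k ^ P k) := by
  rw [coeff_subst (hasSubst_of_constantCoeff_zero hh)]
  simp only [Finsupp.prod_fintype _ _ (fun k => pow_zero (h k)), smul_eq_mul]
  refine finsum_eq_sum_of_support_subset _ fun P hP => ?_
  rw [Finset.mem_coe, mem_degreeLE]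
  by_contra! hlt
  exact hP (by simp only; rw [coeff_prod_pow_of_lt hh (hQ.trans_lt hlt), mul_zero])

theorem le_order_add {F G : MvPowerSeries (Fin n) R} {N : ℕ∞} (hF : N ≤ F.order)
    (hG : N ≤ G.order) : N ≤ (F + G).order :=
  (le_min hF hG).trans min_order_le_add

theorem le_order_mul_of_le {F G : MvPowerSeries (Fin n) R} {a b c : ℕ} (hF : (a : ℕ∞) ≤ F.order)
    (hG : (b : ℕ∞) ≤ G.order) (h : c ≤ a + b) : (c : ℕ∞) ≤ (F * G).order :=
  le_trans (by exact_mod_cast h) ((add_le_add hF hG).trans le_order_mul)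

/-- The truncation of `G ∘ h` to the terms of `G` of degree at most `N` is exact up to order
`N + 1`. -/
theorem le_order_subst_sub_sum {h : Fin n → MvPowerSeries (Fin n) R}
    (hh : ∀ i, constantCoeff (h i) = 0) (G : MvPowerSeries (Fin n) R) (N : ℕ) :
    ((N + 1 : ℕ) : ℕ∞) ≤
      (subst h G - ∑ P ∈ degreeLE n N, coeff P G • ∏ k, h k ^ P k).order := by
  refine nat_le_order fun Q hQ => ?_
  rw [map_sub, coeff_subst_eq_sum hh G (Nat.lt_succ_iff.1 hQ), map_sum]
  simp

/-- Two maps without constant term which agree up to order `N` have monomials of degree `d ≥ 1`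
which agree up to order `N + d - 1`. -/
theorem le_order_prod_pow_sub {h h' : Fin n → MvPowerSeries (Fin n) R}
    (hh : ∀ i, constantCoeff (h i) = 0) (hh' : ∀ i, constantCoeff (h' i) = 0) {N : ℕ}
    (hN : ∀ i, (N : ℕ∞) ≤ (h i - h' i).order) (P : Fin n →₀ ℕ) :
    ((N + P.degree - 1 : ℕ) : ℕ∞) ≤ (∏ k, h k ^ P k - ∏ k, h' k ^ P k).order := by
  induction hd : P.degree generalizing P with
  | zero =>
    rw [Finsupp.degree_eq_zero_iff] at hd
    simp [hd]
  | succ e ih =>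
    obtain ⟨k, hk⟩ : ∃ k, P k ≠ 0 := by
      by_contra! hcon
      have : P = 0 := Finsupp.ext hcon
      simp [this] at hd
    obtain ⟨P', rfl⟩ : ∃ P', P = P' + Finsupp.single k 1 :=
      ⟨P - Finsupp.single k 1, (tsub_add_cancel_of_le (by
        rw [Finsupp.single_le_iff]; omega)).symm⟩
    have hd' : P'.degree = e := by simpa using hd
    have hprod : ∀ g : Fin n → MvPowerSeries (Fin n) R,
        ∏ j, g j ^ (P' + Finsupp.single k 1 : Fin n →₀ ℕ) j = g k * ∏ j, g j ^ P' j := by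
      intro g
      have h1 : ∏ j, g j ^ (Finsupp.single k 1 : Fin n →₀ ℕ) j = g k := by
        rw [Finset.prod_eq_single k (fun j _ hj => by rw [Finsupp.single_eq_of_ne hj, pow_zero])
          (by simp)]
        simp
      simp only [Finsupp.add_apply, pow_add, Finset.prod_mul_distrib]
      rw [h1, mul_comm]
    rw [hprod, hprod]
    have hsplit : h k * ∏ j, h j ^ P' j - h' k * ∏ j, h' j ^ P' j =
        h k * (∏ j, h j ^ P' j - ∏ j, h' j ^ P' j) + (h k - h' k) * ∏ j, h' j ^ P' j := by ring
    rw [hsplit]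
    have h1 : ((1 : ℕ) : ℕ∞) ≤ (h k).order := by
      exact_mod_cast one_le_order_iff_constCoeff_eq_zero.2 (hh k)
    refine le_order_add (le_order_mul_of_le h1 (ih P' hd') (by omega)) ?_
    refine le_order_mul_of_le (hN k) (le_order_prod_pow hh' P') (by omega)

end

/-! ### Flat functions, differential inequalities and evaluation -/

section

open MvPowerSeries Filter Topology

variable {n : ℕ}

/-- A solution of a differential inequality `‖Y'‖ ≤ C ‖Y‖` in complex time which vanishes at one
point vanishes identically. -/
theorem eq_zero_of_norm_deriv_le {D : Set ℂ} (hD : IsOpen D) (hDc : IsPreconnected D)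
    {Y Y' : ℂ → Fin n → ℂ} {C : ℝ} (hY : ∀ s ∈ D, HasDerivAt Y (Y' s) s)
    (hb : ∀ s ∈ D, ‖Y' s‖ ≤ C * ‖Y s‖) {s₀ : ℂ} (hs₀ : s₀ ∈ D) (h0 : Y s₀ = 0) :
    ∀ s ∈ D, Y s = 0 := by
  set Z : Set ℂ := {s | s ∈ D ∧ Y s = 0} with hZ
  have hopen : IsOpen Z := by
    rw [Metric.isOpen_iff]
    rintro s ⟨hsD, hs⟩
    obtain ⟨ε, hε, hball⟩ := Metric.isOpen_iff.1 hD s hsD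
    refine ⟨ε, hε, fun s' hs' => ⟨hball hs', ?_⟩⟩
    set p : ℝ → ℂ := fun τ => s + τ * (s' - s) with hp
    have hpD : ∀ τ ∈ Set.Icc (0 : ℝ) 1, p τ ∈ D := by
      intro τ hτ
      refine hball ?_
      rw [Metric.mem_ball, dist_eq_norm] at hs' ⊢
      simp only [hp, add_sub_cancel_left, norm_mul, Complex.norm_real, Real.norm_eq_abs,
        abs_of_nonneg hτ.1]
      exact (mul_le_of_le_one_left (norm_nonneg _) hτ.2).trans_lt hs'
    have hpd : ∀ τ, HasDerivAt p (s' - s) τ := by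
      intro τ
      have := ((Complex.ofRealCLM.hasDerivAt (x := τ)).mul_const (s' - s)).const_add s
      rw [Complex.ofRealCLM_apply, Complex.ofReal_one, one_mul] at this
      exact this
    have hder : ∀ τ ∈ Set.Icc (0 : ℝ) 1, HasDerivAt (Y ∘ p) ((s' - s) • Y' (p τ)) τ :=
      fun τ hτ => (hY _ (hpD τ hτ)).scomp τ (hpd τ)
    have := eq_zero_of_abs_deriv_le_mul_abs_self_of_eq_zero_right (f := Y ∘ p)
      (f' := fun τ => (s' - s) • Y' (p τ)) (K := ‖s' - s‖ * C) (a := 0) (b := 1)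
      (fun τ hτ => (hder τ hτ).continuousAt.continuousWithinAt)
      (fun τ hτ => (hder τ ⟨hτ.1, hτ.2.le⟩).hasDerivWithinAt)
      (by simpa [hp] using hs)
      (fun τ hτ => by
        rw [norm_smul, mul_assoc]
        gcongr
        exact hb _ (hpD τ ⟨hτ.1, hτ.2.le⟩)) 1 (by simp)
    simpa [hp] using this
  have hsub := hDc.subset_of_closure_inter_subset hopen ⟨s₀, hs₀, hs₀, h0⟩ (by
    rintro s ⟨hs, hsD⟩
    refine ⟨hsD, ?_⟩
    have hcont := (hY s hsD).continuousAt
    have h1 : Y s ∈ closure (Y '' Z) := mem_closure_image hcont hs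
    have h2 : Y '' Z ⊆ {0} := by
      rintro _ ⟨x, hx, rfl⟩
      exact hx.2
    simpa using closure_mono h2 h1)
  exact fun s hs => (hsub hs).2

/-- A holomorphic function of one variable which is flat at `0` vanishes near `0`. -/
theorem eventually_eq_zero_of_flat {f : ℂ → ℂ} (hf : AnalyticAt ℂ f 0)
    (hflat : ∀ N : ℕ, ∃ A : ℝ, ∀ᶠ s in 𝓝 (0 : ℂ), ‖f s‖ ≤ A * ‖s‖ ^ N) :
    ∀ᶠ s in 𝓝 (0 : ℂ), f s = 0 := by
  by_contra hcon
  obtain ⟨N, g, hg, hg0, hfg⟩ := hf.exists_eventuallyEq_pow_smul_nonzero_iff.2 hcon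
  obtain ⟨A, hA⟩ := hflat (N + 1)
  have hle : ∀ᶠ s in 𝓝[≠] (0 : ℂ), ‖g s‖ ≤ A * ‖s‖ := by
    filter_upwards [hfg.filter_mono nhdsWithin_le_nhds, hA.filter_mono nhdsWithin_le_nhds,
      self_mem_nhdsWithin] with s h1 h2 hs
    have hs' : 0 < ‖s‖ ^ N := pow_pos (norm_pos_iff.2 hs) N
    rw [h1, sub_zero, norm_smul, norm_pow, pow_succ, mul_left_comm] at h2
    exact le_of_mul_le_mul_left h2 hs'
  have h1 : Tendsto (fun s => ‖g s‖) (𝓝[≠] (0 : ℂ)) (𝓝 ‖g 0‖) :=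
    hg.continuousAt.norm.tendsto.mono_left nhdsWithin_le_nhds
  have h2 : Tendsto (fun s : ℂ => A * ‖s‖) (𝓝[≠] (0 : ℂ)) (𝓝 0) := by
    have : Continuous fun s : ℂ => A * ‖s‖ := by fun_prop
    simpa using (this.tendsto 0).mono_left nhdsWithin_le_nhds
  have := le_of_tendsto_of_tendsto h1 h2 hle
  exact hg0 (norm_le_zero_iff.1 this)

theorem seriesSum_zero_right (F : MvPowerSeries (Fin n) ℂ) :
    seriesSum F 0 = constantCoeff F := by
  rw [seriesSum, tsum_eq_single 0]
  · simp [seriesTerm]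
  · intro Q hQ
    obtain ⟨k, hk⟩ : ∃ k, Q k ≠ 0 := by
      by_contra! hcon
      exact hQ (Finsupp.ext hcon)
    rw [seriesTerm, Finset.prod_eq_zero (Finset.mem_univ k), mul_zero]
    simp [hk]

theorem seriesSum_sub {F G : MvPowerSeries (Fin n) ℂ} {ρ : NNReal} (hF : F ∈ absConvergent n ρ)
    (hG : G ∈ absConvergent n ρ) {z : Fin n → ℂ} (hz : ‖z‖ ≤ ρ) :
    seriesSum (F - G) z = seriesSum F z - seriesSum G z :=
  map_sub (evalHom z hz) ⟨F, hF⟩ ⟨G, hG⟩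

theorem seriesSum_smul {F : MvPowerSeries (Fin n) ℂ} {ρ : NNReal} (hF : F ∈ absConvergent n ρ)
    {z : Fin n → ℂ} (hz : ‖z‖ ≤ ρ) (a : ℂ) : seriesSum (a • F) z = a * seriesSum F z :=
  map_smul (evalHom z hz) a ⟨F, hF⟩

theorem seriesSum_sum_mul {ι : Type*} (s : Finset ι) {F G : ι → MvPowerSeries (Fin n) ℂ}
    {ρ : NNReal} (hF : ∀ i, F i ∈ absConvergent n ρ) (hG : ∀ i, G i ∈ absConvergent n ρ)
    {z : Fin n → ℂ} (hz : ‖z‖ ≤ ρ) :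
    seriesSum (∑ i ∈ s, F i * G i) z = ∑ i ∈ s, seriesSum (F i) z * seriesSum (G i) z := by
  have := map_sum (evalHom z hz) (fun i => (⟨F i, hF i⟩ * ⟨G i, hG i⟩ : absConvergent n ρ)) s
  simp only [map_mul] at this
  rw [evalHom_apply] at this
  simpa only [AddSubmonoidClass.coe_finsetSum, Subalgebra.coe_mul, evalHom_apply] using this

theorem seriesSum_sum_smul_prod_pow (s : Finset (Fin n →₀ ℕ)) (c : (Fin n →₀ ℕ) → ℂ)
    {h : Fin n → MvPowerSeries (Fin n) ℂ} {ρ : NNReal} (hh : ∀ i, h i ∈ absConvergent n ρ)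
    {z : Fin n → ℂ} (hz : ‖z‖ ≤ ρ) :
    seriesSum (∑ P ∈ s, c P • ∏ k, h k ^ P k) z =
      ∑ P ∈ s, c P * ∏ k, seriesSum (h k) z ^ P k := by
  have := map_sum (evalHom z hz)
    (fun P => c P • ∏ k, (⟨h k, hh k⟩ : absConvergent n ρ) ^ P k) s
  simp only [map_smul, map_prod, map_pow, smul_eq_mul] at this
  rw [evalHom_apply] at this
  simpa [evalHom_apply] using this

/-- Every monomial of the nonlinear part of a normal form is divisible by some `w ^ r j`. -/
theorem exists_le_of_coeff_sum_mul_monomial_ne_zero {l : ℕ} {r : Fin l → (Fin n →₀ ℕ)}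
    {G : Fin l → MvPowerSeries (Fin n) ℂ} {P : Fin n →₀ ℕ}
    (hP : coeff P (∑ j, G j * monomial (r j) (1 : ℂ)) ≠ 0) : ∃ j, r j ≤ P := by
  rw [map_sum] at hP
  obtain ⟨j, -, hj⟩ := Finset.exists_ne_zero_of_sum_ne_zero hP
  refine ⟨j, ?_⟩
  by_contra hle
  exact hj (by rw [coeff_mul_monomial, if_neg hle])

end

/-! ### Invariance of the resonant set -/

section

open MvPowerSeries Filter Topology

variable {n : ℕ}

/-- The map defined by convergent power series. -/
def seriesMap (h : Fin n → MvPowerSeries (Fin n) ℂ) (z : Fin n → ℂ) : Fin n → ℂ :=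
  fun i => seriesSum (h i) z

theorem contDiffAt_seriesMap {h : Fin n → MvPowerSeries (Fin n) ℂ} {ρ : NNReal}
    (hh : ∀ i, h i ∈ absConvergent n ρ) {z : Fin n → ℂ} (hz : ‖z‖ < ρ) :
    ContDiffAt ℂ 1 (seriesMap h) z :=
  contDiffAt_pi.2 fun i => contDiffAt_seriesSum (hh i) hz

theorem seriesMap_zero {h : Fin n → MvPowerSeries (Fin n) ℂ}
    (h0 : ∀ i, constantCoeff (h i) = 0) : seriesMap h 0 = 0 :=
  funext fun i => (seriesSum_zero_right _).trans (h0 i)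

theorem hasFDerivAt_seriesMap_zero {h : Fin n → MvPowerSeries (Fin n) ℂ} {ρ : NNReal}
    (hρ : 0 < ρ) (hh : ∀ i, h i ∈ absConvergent n ρ)
    (h1 : ∀ i k, coeff (Finsupp.single k 1) (h i) = if i = k then 1 else 0) :
    HasFDerivAt (seriesMap h)
      ((ContinuousLinearEquiv.refl ℂ (Fin n → ℂ) : (Fin n → ℂ) →L[ℂ] (Fin n → ℂ))) 0 := by
  refine hasFDerivAt_pi'.2 fun i => ?_
  refine (hasFDerivAt_seriesSum (hh i) (by simpa using hρ)).congr_fderiv ?_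
  have hc : ∀ k, seriesSum (pderiv ℂ k (h i)) 0 = if i = k then 1 else 0 := by
    intro k
    rw [seriesSum_zero_right, ← coeff_zero_eq_constantCoeff_apply, coeff_pderiv, zero_add, h1]
    simp
  refine ContinuousLinearMap.ext fun v => ?_
  simp only [hc, sum_apply, smul_apply, smul_eq_mul,
    ite_mul, one_mul, zero_mul]
  simp

/-- The local inverse of a convergent change of variables tangent to the identity. -/
theorem exists_local_inverse {h : Fin n → MvPowerSeries (Fin n) ℂ} {ρ : NNReal}
    (hρ : 0 < ρ) (hh : ∀ i, h i ∈ absConvergent n ρ) (h0 : ∀ i, constantCoeff (h i) = 0)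
    (h1 : ∀ i k, coeff (Finsupp.single k 1) (h i) = if i = k then 1 else 0) :
    ∃ ψ : (Fin n → ℂ) → (Fin n → ℂ), ContDiffAt ℂ 1 ψ 0 ∧ ψ 0 = 0 ∧
      (∀ᶠ w in 𝓝 0, seriesMap h (ψ w) = w) ∧ ∀ᶠ z in 𝓝 0, ψ (seriesMap h z) = z := by
  have hc : ContDiffAt ℂ 1 (seriesMap h) 0 := contDiffAt_seriesMap hh (by simpa using hρ)
  have hd := hasFDerivAt_seriesMap_zero hρ hh h1
  have hs := hc.hasStrictFDerivAt' hd one_ne_zero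
  have hz := seriesMap_zero h0
  refine ⟨hs.localInverse _ _ _, ?_, ?_, ?_, hs.eventually_left_inverse⟩
  · have := hc.to_localInverse hd one_ne_zero
    rw [hz] at this
    exact this
  · have := hs.localInverse_apply_image
    rwa [hz] at this
  · have := hs.eventually_right_inverse
    rwa [hz] at this

/-- The defect `X(h_i) - lam_i h_i` of a normalization from being linear. -/
def normalFormDefect (lam : Fin n → ℂ) (X h : Fin n → MvPowerSeries (Fin n) ℂ) (i : Fin n) :
    MvPowerSeries (Fin n) ℂ :=
  ∑ k, pderiv ℂ k (h i) * X k - lam i • h i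

/-- On a union of coordinate subspaces where all the `w ^ r j` vanish, the nonlinear part of the
normal form is flat at `0` along each line, hence vanishes. -/
theorem normalFormDefect_comp_inverse_eq_zero {l : ℕ} {r : Fin l → (Fin n →₀ ℕ)}
    {h : Fin n → MvPowerSeries (Fin n) ℂ} {u : MvPowerSeries (Fin n) ℂ}
    {G : Fin l → MvPowerSeries (Fin n) ℂ} {ρ : NNReal} (hρ : 0 < ρ)
    (hh : ∀ i, h i ∈ absConvergent n ρ) (hu : u ∈ absConvergent n ρ)
    (h0 : ∀ i, constantCoeff (h i) = 0)
    (hG : u = subst h (∑ j, G j * monomial (r j) (1 : ℂ)))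
    {ψ : (Fin n → ℂ) → (Fin n → ℂ)} {δ K : ℝ}
    (hdiff : ∀ w ∈ Metric.ball (0 : Fin n → ℂ) δ, DifferentiableAt ℂ (fun w => seriesSum u (ψ w)) w)
    (hinv : ∀ w ∈ Metric.ball (0 : Fin n → ℂ) δ, seriesMap h (ψ w) = w)
    (hψρ : ∀ w ∈ Metric.ball (0 : Fin n → ℂ) δ, ‖ψ w‖ ≤ ρ)
    (hψ : ∀ w ∈ Metric.ball (0 : Fin n → ℂ) δ, ‖ψ w‖ ≤ K * ‖w‖)
    {w : Fin n → ℂ} (hw : w ∈ Metric.ball (0 : Fin n → ℂ) δ)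
    (hwr : ∀ j, ∃ k, r j k ≠ 0 ∧ w k = 0) : seriesSum u (ψ w) = 0 := by
  set U : Set ℂ := (fun s : ℂ => s • w) ⁻¹' Metric.ball 0 δ with hU
  have hcont : Continuous fun s : ℂ => s • w := by fun_prop
  have hUo : IsOpen U := Metric.isOpen_ball.preimage hcont
  have hUc : IsPreconnected U := by
    have : Convex ℝ U := (convex_ball (0 : Fin n → ℂ) δ).is_linear_preimage
      (f := fun s : ℂ => s • w)
      ⟨fun a b => add_smul a b w, fun c a => smul_assoc c a w⟩
    exact this.isPreconnected
  have hδ : 0 < δ := (norm_nonneg _).trans_lt (mem_ball_zero_iff.1 hw)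
  have h0U : (0 : ℂ) ∈ U := by simpa [hU] using hδ
  have h1U : (1 : ℂ) ∈ U := by simpa [hU] using hw
  set f : ℂ → ℂ := fun s => seriesSum u (ψ (s • w)) with hf
  have hfd : DifferentiableOn ℂ f U := fun s hs => by
    have h1 : DifferentiableAt ℂ (fun s : ℂ => s • w) s := by fun_prop
    exact ((hdiff (s • w) hs).comp s h1).differentiableWithinAt
  have hfa : AnalyticOnNhd ℂ f U := hfd.analyticOnNhd hUo
  have hflat : ∀ N : ℕ, ∃ A : ℝ, ∀ᶠ s in 𝓝 (0 : ℂ), ‖f s‖ ≤ A * ‖s‖ ^ N := by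
    intro N
    set g : MvPowerSeries (Fin n) ℂ := ∑ j, G j * monomial (r j) (1 : ℂ) with hg
    set T : MvPowerSeries (Fin n) ℂ := ∑ P ∈ degreeLE n N, coeff P g • ∏ k, h k ^ P k with hT
    have hTmem : T ∈ absConvergent n ρ :=
      sum_mem fun P _ => Subalgebra.smul_mem _ (prod_mem fun k _ => pow_mem (hh k) _) _
    have hord : (N : ℕ∞) ≤ (u - T).order := by
      rw [hG]
      exact le_trans (by exact_mod_cast Nat.le_succ N) (le_order_subst_sub_sum h0 g N)
    obtain ⟨A, hA⟩ := exists_norm_seriesSum_le_pow hρ (sub_mem hu hTmem) hord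
    refine ⟨|A| * (K * ‖w‖) ^ N, ?_⟩
    filter_upwards [hUo.mem_nhds h0U] with s hs
    have hz := hψρ _ hs
    -- Each monomial of `g` contains a coordinate which vanishes along the line of `w`.
    have hTz : seriesSum T (ψ (s • w)) = 0 := by
      rw [hT, seriesSum_sum_smul_prod_pow _ _ hh hz]
      refine Finset.sum_eq_zero fun P _ => ?_
      rcases eq_or_ne (coeff P g) 0 with hP | hP
      · rw [hP, zero_mul]
      obtain ⟨j, hj⟩ := exists_le_of_coeff_sum_mul_monomial_ne_zero hP
      obtain ⟨k, hk, hwk⟩ := hwr j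
      rw [Finset.prod_eq_zero (Finset.mem_univ k), mul_zero]
      have hk' : seriesSum (h k) (ψ (s • w)) = 0 := by
        have := congrFun (hinv _ hs) k
        simpa [seriesMap, hwk] using this
      rw [hk', zero_pow]
      have := hj k
      omega
    have hfs : f s = seriesSum (u - T) (ψ (s • w)) := by
      rw [seriesSum_sub hu hTmem hz, hTz, sub_zero]
    rw [hfs]
    calc _ ≤ A * ‖ψ (s • w)‖ ^ N := hA _ hz
      _ ≤ |A| * (K * ‖s • w‖) ^ N := by
        gcongr
        · exact le_abs_self A
        · exact hψ _ hs
      _ = _ := by rw [norm_smul]; ring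
  have hzero := hfa.eqOn_zero_of_preconnected_of_eventuallyEq_zero hUc h0U
    (eventually_eq_zero_of_flat (hfa 0 h0U) hflat) h1U
  simpa [hf] using hzero

/-- In the coordinates `w = h(z)` the vector field is `w_i' = lam_i w_i + V_i(w)`, where `V` vanishes
wherever all `w ^ r_j` do and is Lipschitz. For a trajectory, let `I` be the set of the indices `k`
with `w_k(s₀) = 0`. Comparing `w` with its projection to `{w_k = 0, k ∈ I}` gives
`‖w_I'‖ ≤ C ‖w_I‖`, so `w_I` vanishes identically. -/
theorem resonantSetInvariant_of_isConvergentSeries {l : ℕ} {lam : Fin n → ℂ}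
    {r : Fin l → (Fin n →₀ ℕ)} {X h : Fin n → MvPowerSeries (Fin n) ℂ}
    (hnorm : IsFormalNormalization lam r X h) (hX : ∀ i, IsConvergentSeries (X i))
    (hh : ∀ i, IsConvergentSeries (h i)) : ResonantSetInvariant r X h := by
  obtain ⟨h0, h1, G, -, hG⟩ := hnorm
  obtain ⟨ρ₁, hρ₁, hmem₁⟩ := exists_common_absConvergent (F := Sum.elim X h) (by
    rintro (i | i)
    · exact hX i
    · exact hh i)
  obtain ⟨ρ, hρ, hρρ₁⟩ := exists_between hρ₁
  have hXm : ∀ i, X i ∈ absConvergent n ρ := fun i => absConvergent_anti hρρ₁.le (hmem₁ (Sum.inl i))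
  have hhm : ∀ i, h i ∈ absConvergent n ρ := fun i => absConvergent_anti hρρ₁.le (hmem₁ (Sum.inr i))
  have hhd : ∀ i k, pderiv ℂ k (h i) ∈ absConvergent n ρ := fun i k =>
    pderiv_mem_absConvergent (hmem₁ (Sum.inr i)) hρρ₁ k
  set u := normalFormDefect lam X h with hu
  have hum : ∀ i, u i ∈ absConvergent n ρ := fun i =>
    sub_mem (sum_mem fun k _ => mul_mem (hhd i k) (hXm k)) (Subalgebra.smul_mem _ (hhm i) _)
  have huG : ∀ i, u i = subst h (∑ j, G i j * monomial (r j) (1 : ℂ)) := fun i => by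
    rw [hu, normalFormDefect, hG i, add_sub_cancel_left]
  obtain ⟨ψ, hψc, hψ0, hright, hleft⟩ := exists_local_inverse hρ hhm h0 h1
  have hρ' : (0 : ℝ) < ρ := by exact_mod_cast hρ
  set V : (Fin n → ℂ) → (Fin n → ℂ) := fun w => seriesMap u (ψ w) with hV
  have hVc : ContDiffAt ℂ 1 V 0 :=
    ContDiffAt.comp (g := seriesMap u) 0 (contDiffAt_seriesMap hum (by simpa [hψ0] using hρ')) hψc
  obtain ⟨K, t, ht, hVK⟩ := hVc.exists_lipschitzOnWith
  obtain ⟨K', t', ht', hψK⟩ := hψc.exists_lipschitzOnWith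
  have hψρ : ∀ᶠ w in 𝓝 0, ‖ψ w‖ ≤ ρ := by
    have : ∀ᶠ w in 𝓝 0, ‖ψ w‖ < ρ :=
      hψc.continuousAt.norm.eventually_lt continuousAt_const (by simpa [hψ0] using hρ')
    filter_upwards [this] with w hw using hw.le
  have hall : ∀ᶠ w in 𝓝 (0 : Fin n → ℂ), DifferentiableAt ℂ V w ∧ seriesMap h (ψ w) = w ∧
      ‖ψ w‖ ≤ ρ ∧ w ∈ t ∧ w ∈ t' := by
    filter_upwards [hVc.eventually (by simp), hright, hψρ, ht, ht'] with w a b c d e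
    exact ⟨a.differentiableAt one_ne_zero, b, c, d, e⟩
  obtain ⟨δ, hδ, hball⟩ := Metric.eventually_nhds_iff_ball.1 hall
  have hVzero : ∀ i, ∀ w ∈ Metric.ball (0 : Fin n → ℂ) δ, (∀ j, ∃ k, r j k ≠ 0 ∧ w k = 0) →
      V w i = 0 := fun i w hw hwr =>
    normalFormDefect_comp_inverse_eq_zero hρ hhm (hum i) h0 (huG i)
      (fun w hw => (differentiableAt_pi.1 (hball w hw).1) i) (fun w hw => (hball w hw).2.1)
      (fun w hw => (hball w hw).2.2.1)
      (fun w hw => by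
        have := hψK.norm_sub_le (hball w hw).2.2.2.2 (mem_of_mem_nhds ht')
        simpa [hψ0] using this) hw hwr
  have hhc : ContinuousAt (seriesMap h) 0 :=
    (contDiffAt_seriesMap hhm (by simpa using hρ')).continuousAt
  have hnear : ∀ᶠ z in 𝓝 (0 : Fin n → ℂ), ψ (seriesMap h z) = z ∧
      seriesMap h z ∈ Metric.ball (0 : Fin n → ℂ) δ := by
    refine hleft.and (hhc.eventually_mem ?_)
    rw [seriesMap_zero h0]
    exact Metric.ball_mem_nhds _ hδ
  obtain ⟨σ, hσ, hσball⟩ := Metric.eventually_nhds_iff_ball.1 hnear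
  have hmono : ∀ {F : MvPowerSeries (Fin n) ℂ}, F ∈ absConvergent n ρ →
      ConvergesOnPolydisc F (min σ ρ) := fun hF z hz =>
    convergesOnPolydisc_of_mem hF z (Metric.ball_subset_ball (min_le_right _ _) hz)
  refine ⟨min σ ρ, lt_min hσ hρ', fun i => hmono (hXm i), fun i => hmono (hhm i), ?_⟩
  rintro D γ hD hDc hγ ⟨s₀, hs₀, hres⟩
  set W : ℂ → Fin n → ℂ := fun s => seriesMap h (γ s) with hW
  have hγρ : ∀ s ∈ D, ‖γ s‖ < ρ := fun s hs =>
    (mem_ball_zero_iff.1 (hγ s hs).1).trans_le (min_le_right _ _)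
  have hγσ : ∀ s ∈ D, γ s ∈ Metric.ball (0 : Fin n → ℂ) σ := fun s hs =>
    Metric.ball_subset_ball (min_le_left _ _) (hγ s hs).1
  have hWd : ∀ s ∈ D, ∀ i, HasDerivAt (fun s => W s i) (lam i * W s i + V (W s) i) s := by
    intro s hs i
    have hd := (hasFDerivAt_seriesSum (hhm i) (hγρ s hs)).comp_hasDerivAt s (hγ s hs).2
    refine hd.congr_deriv ?_
    have hVW : V (W s) i = seriesSum (u i) (γ s) := by
      rw [hV, hW]
      simp only [(hσball _ (hγσ s hs)).1]
      rfl
    rw [hVW, hu, normalFormDefect, seriesSum_sub (sum_mem fun k _ => mul_mem (hhd i k) (hXm k))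
      (Subalgebra.smul_mem _ (hhm i) _) (hγρ s hs).le, seriesSum_smul (hhm i) (hγρ s hs).le,
      seriesSum_sum_mul _ (hhd i) hXm (hγρ s hs).le]
    simp [hW, seriesMap]
  -- Multiplication by `m` extracts the coordinates which vanish at `s₀`.
  set m : Fin n → ℂ := fun k => if W s₀ k = 0 then 1 else 0 with hm
  have hm01 : ∀ k, m k = 0 ∨ m k = 1 := fun k => by
    by_cases h : W s₀ k = 0
    · exact Or.inr (if_pos h)
    · exact Or.inl (if_neg h)
  have hI : ∀ j, ∃ k, r j k ≠ 0 ∧ W s₀ k = 0 := by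
    intro j
    obtain ⟨k, -, hk⟩ := Finset.prod_eq_zero_iff.1 (hres j)
    exact ⟨k, fun h => by simp [h] at hk, eq_zero_of_pow_eq_zero hk⟩
  have hY := eq_zero_of_norm_deriv_le hD hDc (Y := fun s k => m k * W s k)
    (Y' := fun s k => m k * (lam k * W s k + V (W s) k)) (C := ‖lam‖ + K)
    (fun s hs => hasDerivAt_pi.2 fun k => (hWd s hs k).const_mul (m k))
    (fun s hs => by
      set Y : Fin n → ℂ := fun k => m k * W s k with hYdef
      have hWball := (hσball _ (hγσ s hs)).2
      have hWYball : W s - Y ∈ Metric.ball (0 : Fin n → ℂ) δ := by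
        rw [mem_ball_zero_iff] at hWball ⊢
        refine lt_of_le_of_lt ((pi_norm_le_iff_of_nonneg (norm_nonneg _)).2 fun k => ?_) hWball
        rcases hm01 k with h | h
        · simpa [hYdef, h] using norm_le_pi_norm (W s) k
        · simp [hYdef, h]
      have hV0 : ∀ i, V (W s - Y) i = 0 := fun i => by
        refine hVzero i _ hWYball fun j => ?_
        obtain ⟨k, hk, hWk⟩ := hI j
        exact ⟨k, hk, by simp [hYdef, hm, hWk]⟩
      have hVY : ‖V (W s) - V (W s - Y)‖ ≤ K * ‖Y‖ := by
        have := hVK.norm_sub_le (hball _ hWball).2.2.2.1 (hball _ hWYball).2.2.2.1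
        rwa [sub_sub_cancel] at this
      refine (pi_norm_le_iff_of_nonneg (by positivity)).2 fun k => ?_
      rcases hm01 k with h | h
      · simp only [h, zero_mul, norm_zero]
        positivity
      · have h2 : W s k = Y k := by simp [hYdef, h]
        have h3 : ‖V (W s) k‖ ≤ K * ‖Y‖ := by
          have := (norm_le_pi_norm (V (W s) - V (W s - Y)) k).trans hVY
          simpa [hV0 k] using this
        rw [h, one_mul, h2, add_mul]
        refine (norm_add_le _ _).trans (add_le_add ?_ h3)
        rw [norm_mul]
        exact mul_le_mul (norm_le_pi_norm lam k) (norm_le_pi_norm Y k) (norm_nonneg _)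
          (norm_nonneg _))
    hs₀ (by
      funext k
      by_cases h : W s₀ k = 0 <;> simp [hm, h])
  intro s hs j
  obtain ⟨k, hk, hWk⟩ := hI j
  refine Finset.prod_eq_zero (Finset.mem_univ k) ?_
  have := congrFun (hY s hs) k
  simp only [hm, hWk, if_true, one_mul, Pi.zero_apply] at this
  have h2 : seriesSum (h k) (γ s) = 0 := this
  rw [h2, zero_pow hk]

end

/-! ### Formal recursion and differentiation -/

section

open MvPowerSeries

variable {n : ℕ}

/-- Recursion on a degree function: `c Q` is prescribed in terms of the values of `c` in lower
degree, the others being replaced by `0`. -/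
theorem exists_recursion_on_degree {ι V : Type*} [Zero V] (deg : ι → ℕ) (Φ : (ι → V) → ι → V) :
    ∃ c : ι → V, ∀ Q, c Q = Φ (fun P => if deg P < deg Q then c P else 0) Q := by
  classical
  refine ⟨WellFounded.fix (measure deg).wf
    (fun Q rec => Φ (fun P => if hP : deg P < deg Q then rec P hP else 0) Q), fun Q => ?_⟩
  rw [WellFounded.fix_eq]
  congr 1

section Formal

variable {R : Type*} [CommRing R]

theorem le_order_pderiv {F : MvPowerSeries (Fin n) R} {N : ℕ} (hF : ((N + 1 : ℕ) : ℕ∞) ≤ F.order)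
    (k : Fin n) : (N : ℕ∞) ≤ (pderiv R k F).order := by
  refine nat_le_order fun Q hQ => ?_
  rw [coeff_pderiv, coeff_of_lt_order, zero_mul]
  refine lt_of_lt_of_le ?_ hF
  rw [map_add, Finsupp.degree_single]
  exact_mod_cast Nat.succ_lt_succ hQ

/-- The monomials are eigenvectors of the linear vector field `z_k ∂/∂z_k`. -/
theorem coeff_pderiv_mul_X (F : MvPowerSeries (Fin n) R) (k : Fin n) (Q : Fin n →₀ ℕ) :
    coeff Q (pderiv R k F * X k) = (Q k : R) * coeff Q F := by
  rw [X, coeff_mul_monomial, mul_one]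
  split_ifs with h
  · rw [coeff_pderiv, tsub_add_cancel_of_le h, mul_comm]
    congr 1
    have hk : 1 ≤ Q k := Finsupp.single_le_iff.1 h
    have : ((Q - Finsupp.single k 1 : Fin n →₀ ℕ) k) + 1 = Q k := by
      simp only [Finsupp.tsub_apply, Finsupp.single_eq_same]
      omega
    exact_mod_cast congrArg (Nat.cast : ℕ → R) this
  · have hk : Q k = 0 := by
      rw [Finsupp.single_le_iff] at h
      omega
    simp [hk]

theorem map_pderiv {S : Type*} [CommRing S] (e : R →+* S) (F : MvPowerSeries (Fin n) R)
    (k : Fin n) : MvPowerSeries.map e (pderiv R k F) = pderiv S k (MvPowerSeries.map e F) := by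
  ext Q
  simp [coeff_pderiv]

theorem prod_X_pow (P : Fin n →₀ ℕ) :
    ∏ k, (X k : MvPowerSeries (Fin n) R) ^ P k = monomial P 1 := by
  rw [monomial_one_eq, Finsupp.prod_fintype _ _ (fun k => pow_zero _)]

/-- If `h` is tangent to the identity and `G` has order at least `2`, the coefficients of degree
`N` of `G` and `h` contribute to those of `G ∘ h` only through `G` itself. -/
theorem coeff_subst_eq_coeff_add {h h' : Fin n → MvPowerSeries (Fin n) R}
    {G G' : MvPowerSeries (Fin n) R} {Q : Fin n →₀ ℕ}
    (h0 : ∀ i, constantCoeff (h i) = 0) (h0' : ∀ i, constantCoeff (h' i) = 0)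
    (hh : ∀ i, (Q.degree : ℕ∞) ≤ (h i - h' i).order)
    (hX : ∀ i, ((2 : ℕ) : ℕ∞) ≤ (h i - X i).order)
    (hG : ∀ P : Fin n →₀ ℕ, P.degree < 2 → coeff P G = 0)
    (hG' : ∀ P : Fin n →₀ ℕ, coeff P G' = if P.degree < Q.degree then coeff P G else 0) :
    coeff Q (subst h G) = coeff Q G + coeff Q (subst h' G') := by
  rw [coeff_subst_eq_sum h0 G le_rfl, coeff_subst_eq_sum h0' G' le_rfl, ← sub_eq_iff_eq_add,
    ← Finset.sum_sub_distrib, Finset.sum_eq_single Q]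
  · have h1 := le_order_prod_pow_sub h0 (fun i => by simp) hX Q
    by_cases hQ : Q.degree < 2
    · simp [hG Q hQ, hG']
    have h2 : coeff Q (∏ k, h k ^ Q k - ∏ k, X k ^ Q k) = 0 :=
      coeff_of_lt_order (lt_of_lt_of_le (by norm_cast; omega) h1)
    rw [map_sub, prod_X_pow, coeff_monomial_same, sub_eq_zero] at h2
    simp [hG', h2]
  · intro P hP hPQ
    rw [mem_degreeLE] at hP
    rcases lt_or_ge P.degree 2 with h2 | h2
    · simp [hG', hG P h2]
    rcases hP.lt_or_eq with hlt | heq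
    · have h1 := le_order_prod_pow_sub h0 h0' hh P
      have h3 : coeff Q (∏ k, h k ^ P k - ∏ k, h' k ^ P k) = 0 :=
        coeff_of_lt_order (lt_of_lt_of_le (by norm_cast; omega) h1)
      rw [map_sub, sub_eq_zero] at h3
      rw [hG', if_pos hlt, h3, sub_self]
    · have h1 := le_order_prod_pow_sub h0 (fun i => by simp) hX P
      have h3 : coeff Q (∏ k, h k ^ P k - ∏ k, X k ^ P k) = 0 :=
        coeff_of_lt_order (lt_of_lt_of_le (by norm_cast; omega) h1)
      rw [map_sub, prod_X_pow, coeff_monomial_ne hPQ.symm, sub_zero] at h3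
      rw [hG', if_neg (by omega), h3]
      simp
  · intro hQ
    exact absurd (mem_degreeLE.2 le_rfl) hQ

end Formal

/-! ### Degrees in the parameters -/

variable {m : ℕ}

/-- `p` is zero or has total degree at most the integer `x`. -/
def DegreeBound (x : ℤ) (p : MvPolynomial (Fin m) ℂ) : Prop := p = 0 ∨ (p.totalDegree : ℤ) ≤ x

theorem DegreeBound.mono {x y : ℤ} {p : MvPolynomial (Fin m) ℂ} (hp : DegreeBound x p)
    (h : x ≤ y) : DegreeBound y p := hp.imp id fun h' => h'.trans h

theorem DegreeBound.add {x : ℤ} {p q : MvPolynomial (Fin m) ℂ} (hp : DegreeBound x p)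
    (hq : DegreeBound x q) : DegreeBound x (p + q) := by
  rcases hp with rfl | hp
  · rwa [zero_add]
  rcases hq with rfl | hq
  · rw [add_zero]; exact Or.inr hp
  have := MvPolynomial.totalDegree_add p q
  exact Or.inr (by omega)

theorem DegreeBound.mul {x y : ℤ} {p q : MvPolynomial (Fin m) ℂ} (hp : DegreeBound x p)
    (hq : DegreeBound y q) : DegreeBound (x + y) (p * q) := by
  rcases hp with rfl | hp
  · exact Or.inl (zero_mul _)
  rcases hq with rfl | hq
  · exact Or.inl (mul_zero _)
  have := MvPolynomial.totalDegree_mul p q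
  exact Or.inr (by omega)

theorem DegreeBound.C {x : ℤ} (hx : 0 ≤ x) (a : ℂ) :
    DegreeBound x (MvPolynomial.C a : MvPolynomial (Fin m) ℂ) :=
  Or.inr (by simpa using hx)

theorem DegreeBound.C_mul {x : ℤ} {p : MvPolynomial (Fin m) ℂ} (hp : DegreeBound x p) (a : ℂ) :
    DegreeBound x (MvPolynomial.C a * p) := by
  simpa using (DegreeBound.C le_rfl a).mul hp

theorem DegreeBound.sub {x : ℤ} {p q : MvPolynomial (Fin m) ℂ} (hp : DegreeBound x p)
    (hq : DegreeBound x q) : DegreeBound x (p - q) := by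
  rw [sub_eq_add_neg]
  refine hp.add ?_
  simpa using hq.C_mul (-1)

theorem DegreeBound.sum {ι : Type*} {s : Finset ι} {x : ℤ} {p : ι → MvPolynomial (Fin m) ℂ}
    (hp : ∀ i ∈ s, DegreeBound x (p i)) : DegreeBound x (∑ i ∈ s, p i) :=
  Finset.sum_induction _ _ (fun _ _ => DegreeBound.add) (Or.inl rfl) hp

/-- The coefficients of the monomials of degree `N` of `F` have degree at most `d (N - a)` in the
parameters, and vanish if this number is negative. -/
def HasWeight (d : ℕ) (a : ℤ) (F : MvPowerSeries (Fin n) (MvPolynomial (Fin m) ℂ)) : Prop :=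
  ∀ Q, DegreeBound (d * (Q.degree - a)) (coeff Q F)

theorem HasWeight.mul {d : ℕ} {a b : ℤ} {F G : MvPowerSeries (Fin n) (MvPolynomial (Fin m) ℂ)}
    (hF : HasWeight d a F) (hG : HasWeight d b G) : HasWeight d (a + b) (F * G) := by
  intro Q
  rw [coeff_mul]
  refine DegreeBound.sum fun p hp => ((hF p.1).mul (hG p.2)).mono (le_of_eq ?_)
  rw [← Finset.HasAntidiagonal.mem_antidiagonal.1 hp, map_add]
  push_cast
  ring

theorem HasWeight.one {d : ℕ} :
    HasWeight d 0 (1 : MvPowerSeries (Fin n) (MvPolynomial (Fin m) ℂ)) := by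
  intro Q
  rw [coeff_one]
  split_ifs
  · exact Or.inr (by rw [MvPolynomial.totalDegree_one, sub_zero]; positivity)
  · exact Or.inl rfl

theorem HasWeight.pow {d : ℕ} {F : MvPowerSeries (Fin n) (MvPolynomial (Fin m) ℂ)}
    (hF : HasWeight d 1 F) (e : ℕ) : HasWeight d e (F ^ e) := by
  induction e with
  | zero => simpa using HasWeight.one
  | succ e ih =>
    rw [pow_succ, Nat.cast_succ]
    exact ih.mul hF

theorem HasWeight.prod_pow {d : ℕ} {h : Fin n → MvPowerSeries (Fin n) (MvPolynomial (Fin m) ℂ)}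
    (hh : ∀ i, HasWeight d 1 (h i)) (P : Fin n →₀ ℕ) :
    HasWeight d P.degree (∏ k, h k ^ P k) := by
  have : ∀ s : Finset (Fin n), HasWeight d (∑ k ∈ s, P k : ℕ) (∏ k ∈ s, h k ^ P k) := by
    intro s
    classical
    induction s using Finset.induction_on with
    | empty => simpa using HasWeight.one
    | insert k s hk ih =>
      rw [Finset.sum_insert hk, Finset.prod_insert hk, Nat.cast_add]
      exact ((hh k).pow (P k)).mul ih
  rw [Finsupp.degree_eq_sum]
  exact this _

theorem HasWeight.subst {d : ℕ} {h : Fin n → MvPowerSeries (Fin n) (MvPolynomial (Fin m) ℂ)}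
    (h0 : ∀ i, constantCoeff (h i) = 0) (hh : ∀ i, HasWeight d 1 (h i))
    {G : MvPowerSeries (Fin n) (MvPolynomial (Fin m) ℂ)} {a : ℤ} (hG : HasWeight d a G) :
    HasWeight d a (MvPowerSeries.subst h G) := by
  intro Q
  rw [coeff_subst_eq_sum h0 G le_rfl]
  refine DegreeBound.sum fun P _ => ((hG P).mul (HasWeight.prod_pow hh P Q)).mono (le_of_eq ?_)
  ring

theorem HasWeight.pderiv {d : ℕ} {a : ℤ} {F : MvPowerSeries (Fin n) (MvPolynomial (Fin m) ℂ)}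
    (hF : HasWeight d a F) (k : Fin n) : HasWeight d (a - 1) (MvPowerSeries.pderiv (MvPolynomial (Fin m) ℂ) k F) := by
  intro Q
  have h1 : coeff Q (MvPowerSeries.pderiv (MvPolynomial (Fin m) ℂ) k F) =
      MvPolynomial.C ((Q k : ℂ) + 1) * coeff (Q + Finsupp.single k 1) F := by
    rw [coeff_pderiv, mul_comm, map_add, map_natCast, map_one]
  have h2 := (hF (Q + Finsupp.single k 1)).C_mul ((Q k : ℂ) + 1)
  rw [← h1] at h2
  refine h2.mono (le_of_eq ?_)
  rw [map_add, Finsupp.degree_single]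
  push_cast
  ring

theorem HasWeight.sum {ι : Type*} {s : Finset ι} {d : ℕ} {a : ℤ}
    {F : ι → MvPowerSeries (Fin n) (MvPolynomial (Fin m) ℂ)} (hF : ∀ i ∈ s, HasWeight d a (F i)) :
    HasWeight d a (∑ i ∈ s, F i) := fun Q => by
  rw [map_sum]
  exact DegreeBound.sum fun i hi => hF i hi Q

end

/-! ### The Poincaré–Dulac normal form -/

section

open MvPowerSeries

variable {n m : ℕ}

/-- The power series with prescribed coefficients. -/
def seriesOfCoeff {R : Type*} (c : (Fin n →₀ ℕ) → R) : MvPowerSeries (Fin n) R := c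

theorem coeff_seriesOfCoeff {R : Type*} [CommRing R] (c : (Fin n →₀ ℕ) → R) (Q : Fin n →₀ ℕ) :
    coeff Q (seriesOfCoeff c) = c Q := rfl

/-- The coefficient of `∑_k ∂h_i/∂z_k F_k - g_i ∘ h` at `Q`, where the first and second components
of `v` are the coefficients of `h` and `g`. -/
def homologicalError {R : Type*} [CommRing R] (F : Fin n → MvPowerSeries (Fin n) R)
    (v : (Fin n →₀ ℕ) → (Fin n → R) × (Fin n → R)) (Q : Fin n →₀ ℕ) (i : Fin n) : R :=
  coeff Q (∑ k, pderiv R k (seriesOfCoeff fun P => (v P).1 i) * F k) -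
    coeff Q (subst (fun j => seriesOfCoeff fun P => (v P).1 j) (seriesOfCoeff fun P => (v P).2 i))

open Classical in
/-- The Poincaré–Dulac construction: the homological equation is solved degree by degree, the
resonant terms being kept in the normal form and the free coefficients of `H` being set to `0`. -/
theorem exists_formal_normal_form (lam : Fin n → ℂ) (d : ℕ)
    (F : Fin n → MvPowerSeries (Fin n) (MvPolynomial (Fin m) ℂ))
    (hF : ∀ k, ((2 : ℕ) : ℕ∞) ≤ (F k).order) (hFw : ∀ k, HasWeight d 1 (F k)) :
    ∃ H g : Fin n → MvPowerSeries (Fin n) (MvPolynomial (Fin m) ℂ),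
      (∀ i, constantCoeff (H i) = 0) ∧
      (∀ i k, coeff (Finsupp.single k 1) (H i) = if i = k then 1 else 0) ∧
      (∀ i, HasWeight d 1 (H i)) ∧
      (∀ i P, coeff P (g i) ≠ 0 → IsResonance lam i P) ∧
      ∀ i, ∑ k, pderiv _ k (H i) * ((MvPolynomial.C (lam k) : MvPolynomial (Fin m) ℂ) • X k + F k) =
        (MvPolynomial.C (lam i) : MvPolynomial (Fin m) ℂ) • H i + subst H (g i) := by
  obtain ⟨v, hv⟩ := exists_recursion_on_degree
    (V := (Fin n → MvPolynomial (Fin m) ℂ) × (Fin n → MvPolynomial (Fin m) ℂ))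
    (fun Q : Fin n →₀ ℕ => Q.degree) (fun v Q =>
      (fun i => if Q.degree < 2 then (if Q = Finsupp.single i 1 then 1 else 0) else
        if pairing Q lam = lam i then 0 else
          MvPolynomial.C (lam i - pairing Q lam)⁻¹ * homologicalError F v Q i,
       fun i => if IsResonance lam i Q then homologicalError F v Q i else 0))
  set tr : (Fin n →₀ ℕ) → (Fin n →₀ ℕ) →
    (Fin n → MvPolynomial (Fin m) ℂ) × (Fin n → MvPolynomial (Fin m) ℂ) :=
    fun Q P => if P.degree < Q.degree then v P else 0 with htr
  set H : Fin n → MvPowerSeries (Fin n) (MvPolynomial (Fin m) ℂ) :=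
    fun i => seriesOfCoeff fun P => (v P).1 i with hH
  set g : Fin n → MvPowerSeries (Fin n) (MvPolynomial (Fin m) ℂ) :=
    fun i => seriesOfCoeff fun P => (v P).2 i with hg
  have hHQ : ∀ i Q, coeff Q (H i) = if Q.degree < 2 then
      (if Q = Finsupp.single i 1 then 1 else 0) else if pairing Q lam = lam i then 0 else
        MvPolynomial.C (lam i - pairing Q lam)⁻¹ * homologicalError F (tr Q) Q i := by
    intro i Q
    rw [hH, coeff_seriesOfCoeff, hv Q]
  have hgQ : ∀ i Q, coeff Q (g i) = if IsResonance lam i Q then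
      homologicalError F (tr Q) Q i else 0 := by
    intro i Q
    rw [hg, coeff_seriesOfCoeff, hv Q]
  have hH0 : ∀ i, constantCoeff (H i) = 0 := by
    intro i
    rw [← coeff_zero_eq_constantCoeff_apply, hHQ, if_pos (by simp), if_neg]
    intro h
    have := DFunLike.congr_fun h i
    simp at this
  have hH1 : ∀ i k, coeff (Finsupp.single k 1) (H i) = if i = k then 1 else 0 := by
    intro i k
    rw [hHQ, if_pos (by simp)]
    congr 1
    rw [Finsupp.single_left_inj one_ne_zero]
    exact propext eq_comm
  have hg2 : ∀ i, ∀ P : Fin n →₀ ℕ, P.degree < 2 → coeff P (g i) = 0 := by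
    intro i P hP
    rw [hgQ, if_neg]
    exact fun h => absurd h.1 (by omega)
  have hHX : ∀ i, ((2 : ℕ) : ℕ∞) ≤ (H i - X i).order := by
    intro i
    refine nat_le_order fun P hP => ?_
    rw [map_sub, hHQ, if_pos hP, coeff_X, sub_self]
  set H' : (Fin n →₀ ℕ) → Fin n → MvPowerSeries (Fin n) (MvPolynomial (Fin m) ℂ) :=
    fun Q i => seriesOfCoeff fun P => (tr Q P).1 i with hH'
  set g' : (Fin n →₀ ℕ) → Fin n → MvPowerSeries (Fin n) (MvPolynomial (Fin m) ℂ) :=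
    fun Q i => seriesOfCoeff fun P => (tr Q P).2 i with hg'
  have hH'c : ∀ Q i P, coeff P (H' Q i) = if P.degree < Q.degree then coeff P (H i) else 0 := by
    intro Q i P
    simp only [hH', hH, coeff_seriesOfCoeff, htr]
    split_ifs <;> rfl
  have hg'c : ∀ Q i P, coeff P (g' Q i) = if P.degree < Q.degree then coeff P (g i) else 0 := by
    intro Q i P
    simp only [hg', hg, coeff_seriesOfCoeff, htr]
    split_ifs <;> rfl
  have hH'0 : ∀ Q i, constantCoeff (H' Q i) = 0 := by
    intro Q i
    rw [← coeff_zero_eq_constantCoeff_apply, hH'c, coeff_zero_eq_constantCoeff_apply, hH0, ite_self]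
  have hHH' : ∀ Q i, (Q.degree : ℕ∞) ≤ (H i - H' Q i).order := by
    intro Q i
    refine nat_le_order fun P hP => ?_
    rw [map_sub, hH'c, if_pos hP, sub_self]
  have herr : ∀ Q i, homologicalError F (tr Q) Q i =
      coeff Q (∑ k, pderiv _ k (H' Q i) * F k) - coeff Q (subst (H' Q) (g' Q i)) :=
    fun Q i => rfl
  -- The equation at `Q` involves the coefficients of degree `|Q|` of `H` and `g` only through
  -- `((Q, lam) - lam i) H_Q = g_Q + ...`.
  have hmain : ∀ Q i, coeff Q (∑ k, pderiv _ k (H i) * F k) - coeff Q (subst H (g i)) =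
      homologicalError F (tr Q) Q i - coeff Q (g i) := by
    intro Q i
    rw [herr, coeff_subst_eq_coeff_add hH0 (hH'0 Q) (hHH' Q) hHX (hg2 i) (hg'c Q i)]
    have h1 : coeff Q (∑ k, pderiv _ k (H i) * F k) =
        coeff Q (∑ k, pderiv _ k (H' Q i) * F k) := by
      rw [← sub_eq_zero, ← map_sub, ← Finset.sum_sub_distrib, map_sum]
      refine Finset.sum_eq_zero fun k _ => ?_
      rw [← sub_mul, ← map_sub]
      rcases Nat.eq_zero_or_pos Q.degree with h0 | h0
      · refine coeff_of_lt_order (lt_of_lt_of_le ?_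
          (le_order_mul_of_le (a := 0) (c := 2) (by simp) (hF k) (by omega)))
        rw [h0]
        norm_num
      · obtain ⟨N, hN⟩ := Nat.exists_eq_succ_of_ne_zero h0.ne'
        have h2 := hHH' Q i
        rw [hN] at h2
        refine coeff_of_lt_order (lt_of_lt_of_le ?_
          (le_order_mul_of_le (c := N + 2) (le_order_pderiv h2 k) (hF k) le_rfl))
        rw [hN]
        norm_cast
        omega
    rw [h1]
    ring
  refine ⟨H, g, hH0, hH1, ?_, ?_, ?_⟩
  · have key : ∀ N : ℕ, ∀ Q : Fin n →₀ ℕ, Q.degree < N → ∀ i,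
        DegreeBound (d * (Q.degree - 1)) (coeff Q (H i)) ∧
        DegreeBound (d * (Q.degree - 1)) (coeff Q (g i)) := by
      intro N
      induction N with
      | zero => intro Q hQ; omega
      | succ N ih =>
        intro Q hQ i
        have hw : ∀ j, HasWeight d 1 (H' Q j) := by
          intro j P
          rw [hH'c]
          split_ifs with hP
          · exact (ih P (by omega) j).1
          · exact Or.inl rfl
        have hw' : HasWeight d 1 (g' Q i) := by
          intro P
          rw [hg'c]
          split_ifs with hP
          · exact (ih P (by omega) i).2
          · exact Or.inl rfl
        have hE : DegreeBound (d * (Q.degree - 1)) (homologicalError F (tr Q) Q i) := by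
          rw [herr]
          refine DegreeBound.sub ?_ (HasWeight.subst (hH'0 Q) hw hw' Q)
          refine HasWeight.sum (fun k _ => ?_) Q
          simpa using ((hw i).pderiv k).mul (hFw k)
        constructor
        · rw [hHQ]
          split_ifs with h2 h3 h4
          · refine Or.inr ?_
            rw [MvPolynomial.totalDegree_one, h3]
            simp
          · exact Or.inl rfl
          · exact Or.inl rfl
          · exact hE.C_mul _
        · rw [hgQ]
          split_ifs
          · exact hE
          · exact Or.inl rfl
    exact fun i Q => (key (Q.degree + 1) Q (Nat.lt_succ_self _) i).1
  · intro i P hP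
    rw [hgQ] at hP
    by_contra hcon
    exact hP (if_neg hcon)
  · intro i
    ext1 Q
    have hlin : coeff Q (∑ k, pderiv _ k (H i) *
        ((MvPolynomial.C (lam k) : MvPolynomial (Fin m) ℂ) • X k + F k)) =
        MvPolynomial.C (pairing Q lam) * coeff Q (H i) +
          coeff Q (∑ k, pderiv _ k (H i) * F k) := by
      simp only [mul_add, Finset.sum_add_distrib, map_add]
      congr 1
      rw [map_sum, pairing, map_sum, Finset.sum_mul]
      refine Finset.sum_congr rfl fun k _ => ?_
      rw [mul_smul_comm, coeff_smul, coeff_pderiv_mul_X, map_mul, map_natCast]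
      ring
    have h1 := hmain Q i
    rw [hlin, map_add, coeff_smul]
    have hgoal : MvPolynomial.C (pairing Q lam) * coeff Q (H i) +
        homologicalError F (tr Q) Q i = MvPolynomial.C (lam i) * coeff Q (H i) + coeff Q (g i) := by
      by_cases h2 : Q.degree < 2
      · have hgz := hg2 i Q h2
        have hz1 : coeff Q (∑ k, pderiv _ k (H i) * F k) = 0 := by
          rw [map_sum]
          refine Finset.sum_eq_zero fun k _ => coeff_of_lt_order (lt_of_lt_of_le ?_
            (le_order_mul_of_le (a := 0) (c := 2) (by simp) (hF k) (by omega)))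
          exact_mod_cast h2
        have hz2 : coeff Q (subst H (g i)) = 0 := by
          rw [coeff_subst_eq_sum hH0 (g i) le_rfl]
          refine Finset.sum_eq_zero fun P hP => ?_
          rw [hg2 i P ((mem_degreeLE.1 hP).trans_lt h2), zero_mul]
        rw [hz1, hz2, hgz] at h1
        have hE0 : homologicalError F (tr Q) Q i = 0 := by simpa using h1.symm
        rw [hE0, hgz, add_zero, add_zero, hHQ, if_pos h2]
        split_ifs with h3
        · rw [h3]
          congr 2
          rw [pairing, Finset.sum_eq_single i] <;> simp +contextual
        · simp
      · have h3 := hHQ i Q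
        have h4 := hgQ i Q
        rw [if_neg h2] at h3
        by_cases h5 : pairing Q lam = lam i
        · rw [if_pos ⟨by omega, h5⟩] at h4
          rw [h4, h5]
        · rw [if_neg h5] at h3
          rw [if_neg fun h => h5 h.2] at h4
          rw [h4, h3]
          have h6 : (MvPolynomial.C (lam i - pairing Q lam) : MvPolynomial (Fin m) ℂ) *
              MvPolynomial.C (lam i - pairing Q lam)⁻¹ = 1 := by
            rw [← map_mul, mul_inv_cancel₀ (sub_ne_zero.2 (Ne.symm h5)), map_one]
          rw [map_sub] at h6
          linear_combination (-homologicalError F (tr Q) Q i) * h6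
    linear_combination h1 + hgoal

end

/-! ### Normalization of the family -/

section

open MvPowerSeries

variable {n m l : ℕ}

theorem exists_generator_le_of_isResonance {lam : Fin n → ℂ} {r : Fin l → (Fin n →₀ ℕ)}
    (hgen : ResonancesGeneratedBy lam r) {i : Fin n} {Q : Fin n →₀ ℕ} (hQ : IsResonance lam i Q) :
    ∃ j, r j ≤ Q := by
  obtain ⟨P, c, hP, rfl⟩ := hgen.2 i Q hQ
  obtain ⟨j, hj⟩ : ∃ j, c j ≠ 0 := by
    by_contra! hcon
    have h2 := hQ.1
    simp [hcon] at h2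
    omega
  refine ⟨j, le_add_left ?_⟩
  calc r j = 1 • r j := (one_smul _ _).symm
    _ ≤ c j • r j := nsmul_le_nsmul_left (zero_le) (Nat.one_le_iff_ne_zero.2 hj)
    _ ≤ ∑ j, c j • r j := Finset.single_le_sum (f := fun j => c j • r j)
        (fun _ _ => zero_le) (Finset.mem_univ j)

open Classical in
/-- A series of resonant monomials is a combination of the generators of the resonances. -/
theorem exists_sum_mul_monomial_eq {lam : Fin n → ℂ} {r : Fin l → (Fin n →₀ ℕ)}
    (hgen : ResonancesGeneratedBy lam r) {i : Fin n} {g : MvPowerSeries (Fin n) ℂ}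
    (hg : ∀ P, coeff P g ≠ 0 → IsResonance lam i P) :
    ∃ G : Fin l → MvPowerSeries (Fin n) ℂ,
      (∀ j, (r j).degree = 1 → constantCoeff (G j) = 0) ∧
        ∑ j, G j * monomial (r j) (1 : ℂ) = g := by
  -- Each monomial of `g` is assigned to one generator dividing it.
  have hex : ∀ P, ∃ o : Option (Fin l), coeff P g ≠ 0 → ∃ j, o = some j ∧ r j ≤ P := by
    intro P
    by_cases hP : coeff P g = 0
    · exact ⟨none, fun h => absurd hP h⟩
    · obtain ⟨j, hj⟩ := exists_generator_le_of_isResonance hgen (hg P hP)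
      exact ⟨some j, fun _ => ⟨j, rfl, hj⟩⟩
  choose o ho using hex
  refine ⟨fun j => seriesOfCoeff fun P => if o (P + r j) = some j then coeff (P + r j) g else 0,
    fun j hj => ?_, ?_⟩
  · rw [← coeff_zero_eq_constantCoeff_apply, coeff_seriesOfCoeff, zero_add]
    split_ifs
    · by_contra hne
      have := (hg _ hne).1
      omega
    · rfl
  · ext P
    have hterm : ∀ j, coeff P (seriesOfCoeff (fun P => if o (P + r j) = some j then
        coeff (P + r j) g else 0) * monomial (r j) (1 : ℂ)) =
        if r j ≤ P ∧ o P = some j then coeff P g else 0 := by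
      intro j
      rw [coeff_mul_monomial, mul_one]
      by_cases h : r j ≤ P
      · rw [if_pos h, coeff_seriesOfCoeff, tsub_add_cancel_of_le h]
        simp [h]
      · simp [h]
    rw [map_sum, Finset.sum_congr rfl fun j _ => hterm j]
    by_cases hP : coeff P g = 0
    · simp [hP]
    · obtain ⟨j, hoj, hj⟩ := ho P hP
      rw [Finset.sum_eq_single j]
      · simp [hj, hoj]
      · intro j' _ hj'
        rw [if_neg]
        rintro ⟨-, h⟩
        rw [hoj] at h
        exact hj' (Option.some.inj h).symm
      · simp

/-- The nonlinear part of the family of vector fields, with the parameters as indeterminates. -/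
def genericNonlinearity (d : ℕ) (f : (Fin m →₀ ℕ) → Fin n → MvPowerSeries (Fin n) ℂ) (j : Fin n) :
    MvPowerSeries (Fin n) (MvPolynomial (Fin m) ℂ) :=
  ∑ e ∈ Finset.range (d + 1), ∑ i ∈ Finset.finsuppAntidiag Finset.univ e,
    (∏ s, MvPolynomial.X s ^ i s : MvPolynomial (Fin m) ℂ) •
      MvPowerSeries.map (MvPolynomial.C (σ := Fin m)) (f i j)

theorem degree_eq_of_mem_finsuppAntidiag {i : Fin m →₀ ℕ} {e : ℕ}
    (hi : i ∈ Finset.finsuppAntidiag Finset.univ e) : i.degree = e := by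
  rw [Finset.mem_finsuppAntidiag] at hi
  rw [Finsupp.degree_eq_sum]
  exact hi.1

theorem map_smul_eq {R S : Type*} [CommRing R] [CommRing S] (e : R →+* S) (a : R)
    (F : MvPowerSeries (Fin n) R) :
    MvPowerSeries.map e (a • F) = e a • MvPowerSeries.map e F := by
  ext Q
  simp

theorem map_eval_genericNonlinearity (lam : Fin n → ℂ) (d : ℕ)
    (f : (Fin m →₀ ℕ) → Fin n → MvPowerSeries (Fin n) ℂ) (t : Fin m → ℂ) (j : Fin n) :
    MvPowerSeries.map (MvPolynomial.eval t)
      ((MvPolynomial.C (lam j) : MvPolynomial (Fin m) ℂ) • X j + genericNonlinearity d f j) =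
      vectorFieldFamily lam d f t j := by
  rw [map_add, map_smul_eq, MvPolynomial.eval_C, map_X, vectorFieldFamily, genericNonlinearity,
    map_sum]
  congr 1
  refine Finset.sum_congr rfl fun e _ => ?_
  rw [map_sum]
  refine Finset.sum_congr rfl fun i _ => ?_
  rw [map_smul_eq, map_prod]
  congr 1
  · simp
  · ext Q
    simp

theorem coeff_genericNonlinearity_eq_zero {d : ℕ}
    {f : (Fin m →₀ ℕ) → Fin n → MvPowerSeries (Fin n) ℂ}
    (hval : ∀ i j, i.degree ≤ d → ∀ Q : Fin n →₀ ℕ, Q.degree < 2 → coeff Q (f i j) = 0)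
    (j : Fin n) {Q : Fin n →₀ ℕ} (hQ : Q.degree < 2) :
    coeff Q (genericNonlinearity d f j) = 0 := by
  rw [genericNonlinearity, map_sum]
  refine Finset.sum_eq_zero fun e he => ?_
  rw [map_sum]
  refine Finset.sum_eq_zero fun i hi => ?_
  rw [Finset.mem_range] at he
  rw [coeff_smul, coeff_map, hval i j (by rw [degree_eq_of_mem_finsuppAntidiag hi]; omega) Q hQ,
    map_zero, mul_zero]

theorem hasWeight_genericNonlinearity {d : ℕ}
    {f : (Fin m →₀ ℕ) → Fin n → MvPowerSeries (Fin n) ℂ}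
    (hval : ∀ i j, i.degree ≤ d → ∀ Q : Fin n →₀ ℕ, Q.degree < 2 → coeff Q (f i j) = 0)
    (j : Fin n) : HasWeight d 1 (genericNonlinearity d f j) := by
  intro Q
  rcases lt_or_ge Q.degree 2 with hQ | hQ
  · exact Or.inl (coeff_genericNonlinearity_eq_zero hval j hQ)
  have hd : DegreeBound d (coeff Q (genericNonlinearity d f j)) := by
    rw [genericNonlinearity, map_sum]
    refine DegreeBound.sum fun e he => ?_
    rw [map_sum]
    refine DegreeBound.sum fun i hi => ?_
    rw [Finset.mem_range] at he
    rw [coeff_smul, coeff_map, mul_comm]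
    refine DegreeBound.C_mul (Or.inr ?_) _
    have h1 : (∏ s, MvPolynomial.X s ^ i s : MvPolynomial (Fin m) ℂ).totalDegree ≤ i.degree := by
      refine (MvPolynomial.totalDegree_finsetProd _ _).trans ?_
      rw [Finsupp.degree_eq_sum]
      exact Finset.sum_le_sum fun s _ => by rw [MvPolynomial.totalDegree_X_pow]
    rw [degree_eq_of_mem_finsuppAntidiag hi] at h1
    omega
  refine hd.mono ?_
  have : (1 : ℤ) ≤ (Q.degree : ℤ) - 1 := by omega
  nlinarith

/-- The normalization is constructed over the ring of polynomials in the parameters and then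
specialized. -/
theorem exists_isPolynomialNormalization {d : ℕ} {lam : Fin n → ℂ} {r : Fin l → (Fin n →₀ ℕ)}
    {f : (Fin m →₀ ℕ) → Fin n → MvPowerSeries (Fin n) ℂ}
    (hval : ∀ i j, i.degree ≤ d → ∀ Q : Fin n →₀ ℕ, Q.degree < 2 → coeff Q (f i j) = 0)
    (hgen : ResonancesGeneratedBy lam r) :
    ∃ h : Fin n → MvPowerSeries (Fin n) (MvPolynomial (Fin m) ℂ),
      IsPolynomialNormalization lam r (vectorFieldFamily lam d f) h := by
  obtain ⟨H, g, hH0, hH1, hHw, hg, heq⟩ := exists_formal_normal_form lam d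
    (genericNonlinearity d f)
    (fun k => nat_le_order fun Q hQ => coeff_genericNonlinearity_eq_zero hval k hQ)
    (hasWeight_genericNonlinearity hval)
  refine ⟨H, fun t => ⟨fun i => ?_, fun i k => ?_, ?_⟩, 0, d, fun i Q => ?_⟩
  · rw [specialize, ← coeff_zero_eq_constantCoeff_apply, coeff_map,
      coeff_zero_eq_constantCoeff_apply, hH0, map_zero]
  · rw [specialize, coeff_map, hH1]
    split_ifs <;> simp
  · have hgt : ∀ i P, coeff P (MvPowerSeries.map (MvPolynomial.eval t) (g i)) ≠ 0 →
        IsResonance lam i P := fun i P hP => hg i P fun h0 => hP (by rw [coeff_map, h0, map_zero])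
    choose G hG0 hG using fun i => exists_sum_mul_monomial_eq hgen (hgt i)
    refine ⟨G, hG0, fun i => ?_⟩
    have h := congrArg (MvPowerSeries.map (MvPolynomial.eval t)) (heq i)
    rw [map_sum, map_add, map_smul_eq, MvPolynomial.eval_C,
      map_subst (hasSubst_of_constantCoeff_zero hH0)] at h
    rw [hG i]
    refine Eq.trans (Finset.sum_congr rfl fun k _ => ?_) h
    rw [map_mul, map_pderiv, map_eval_genericNonlinearity]
    rfl
  · rcases hHw i Q with h0 | h0
    · rw [h0]; simp
    · have : (d : ℤ) * (Q.degree - 1) ≤ d * Q.degree := by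
        gcongr
        omega
      rw [zero_add]
      exact_mod_cast h0.trans this

theorem isConvergentSeries_vectorFieldFamily {lam : Fin n → ℂ} {d : ℕ}
    {f : (Fin m →₀ ℕ) → Fin n → MvPowerSeries (Fin n) ℂ}
    (hconv : ∀ i j, i.degree ≤ d → IsConvergentSeries (f i j)) (t : Fin m → ℂ) (j : Fin n) :
    IsConvergentSeries (vectorFieldFamily lam d f t j) := by
  obtain ⟨ρ, hρ, hmem⟩ := exists_common_absConvergent
    (F := fun i : degreeLE m d => f i.1 j) fun i => hconv _ j (mem_degreeLE.1 i.2)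
  have hX : (X j : MvPowerSeries (Fin n) ℂ) ∈ absConvergent n ρ := by
    refine mem_absConvergent.2 (summable_of_ne_finset_zero (s := {Finsupp.single j 1})
      fun Q hQ => ?_)
    rw [Finset.mem_singleton] at hQ
    simp [coeff_X, hQ]
  refine isConvergentSeries_of_mem hρ (add_mem (Subalgebra.smul_mem _ hX _)
    (sum_mem fun e he => sum_mem fun i hi => Subalgebra.smul_mem _ (hmem ⟨i, ?_⟩) _))
  rw [mem_degreeLE, degree_eq_of_mem_finsuppAntidiag hi]
  exact Nat.lt_succ_iff.1 (Finset.mem_range.1 he)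

end

end

theorem theorem4 {n m l d : ℕ} (hm : 1 ≤ m)
    (lam : Fin n → ℂ) (r : Fin l → (Fin n →₀ ℕ))
    (f : (Fin m →₀ ℕ) → Fin n → MvPowerSeries (Fin n) ℂ)
    (hconv : ∀ i j, i.degree ≤ d → IsConvergentSeries (f i j))
    (hval : ∀ i j, i.degree ≤ d → ∀ Q : Fin n →₀ ℕ, Q.degree < 2 →
      MvPowerSeries.coeff Q (f i j) = 0)
    (hSiegel : (0 : ℂ) ∈ convexHull ℝ (Set.range lam))
    (hres : ∃ i Q, IsResonance lam i Q)
    (hgen : ResonancesGeneratedBy lam r) :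
    (∃ h : Fin n → MvPowerSeries (Fin n) (MvPolynomial (Fin m) ℂ),
      IsPolynomialNormalization lam r (vectorFieldFamily lam d f) h) ∧
    ∀ h : Fin n → MvPowerSeries (Fin n) (MvPolynomial (Fin m) ℂ),
      IsPolynomialNormalization lam r (vectorFieldFamily lam d f) h →
      (∀ t : Fin m → ℂ, (∀ i, IsConvergentSeries (specialize h t i)) ∧
        ResonantSetInvariant r (vectorFieldFamily lam d f t) (specialize h t)) ∨
      (∃ E : Set (Fin m → ℂ), gammaCapacity m E = 0 ∧
        ∀ t, t ∉ E → ¬ ∀ i, IsConvergentSeries (specialize h t i)) := by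
  refine ⟨exists_isPolynomialNormalization hval hgen, ?_⟩
  rintro h ⟨hnorm, C₀, C₁, hdeg⟩
  set p : Fin n × (Fin n →₀ ℕ) → MvPolynomial (Fin m) ℂ :=
    fun α => MvPowerSeries.coeff α.2 (h α.1) with hp
  set N : Fin n × (Fin n →₀ ℕ) → ℕ := fun α => α.2.degree + 1 with hN
  have hconvIff : ∀ t, (∀ i, IsConvergentSeries (specialize h t i)) ↔ t ∈ growthSet p N := by
    intro t
    rw [forall_isConvergentSeries_iff_geometric_bound]
    simp only [growthSet, Set.mem_ofPred_eq, Prod.forall, hp, hN, specialize,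
      MvPowerSeries.coeff_map]
  by_cases hcap : gammaCapacity m (growthSet p N) = 0
  · exact Or.inr ⟨growthSet p N, hcap, fun t ht hc => ht ((hconvIff t).1 hc)⟩
  · refine Or.inl fun t => ?_
    have hc := (hconvIff t).2 (mem_growthSet_of_gammaCapacity_ne_zero p (C := C₀ + C₁)
      (fun α => (hdeg α.1 α.2).trans (by simp only [hN]; nlinarith)) hcap t)
    exact ⟨hc, resonantSetInvariant_of_isConvergentSeries (hnorm t)
      (isConvergentSeries_vectorFieldFamily hconv t) hc⟩
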